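/- Let $d\ge 2$ and $\mathcal X=\mathbb C^d$. Operators carry the Hilbert--Schmidt inner product $\langle X,Y\rangle=\operatorname{Tr}(X^*Y)$, and $\|X\|_1=\operatorname{Tr}\sqrt{X^*X}$. For a Hermiticity-preserving linear map $\Phi$ from operators on $\mathcal X$ to operators on a finite-dimensional space $\mathcal Y$ put $$\|\Phi\|_{\rm NE}=\max_{\rho}\|\Phi(\rho)\|_1,\qquad \|\Phi\|_\diamond=\max_{\rho}\|(\Phi\otimes 1_{L(\mathcal X)})(\rho)\|_1,\qquad \|\Phi\|_{\rm LOCC}=\max_{\{P_0,P_1\}}\max_\rho\,\langle P_0-P_1,(\Phi\otimes 1_{L(\mathcal Z)})(\rho)\rangle ,$$ where $\rho$ ranges over the density operators on $\mathcal X$, on $\mathcal X\otimes\mathcal X$ and on $\mathcal X\otimes\mathcal Z$, respectively, $\mathcal Z$ is any space with $\dim\mathcal Z\ge\dim\mathcal X$, and $\{P_0,P_1\}$ ranges over the LOCC measurements on $\mathcal Y\otimes\mathcal Z$, i.e. the closure of the set of binary-valued measurements that can be implemented by local operations and finitely many rounds of classical communication between the holder of $\mathcal Y$ and the holder of $\mathcal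 Z$. (1) Let $\{A_{a,j}: a\in\{0,1\},\,1\le j\le n\}$ be operators on $\mathcal X$ with $\sum_j A_{0,j}^*A_{0,j}=\sum_j A_{1,j}^*A_{1,j}=1$, and let $\Phi_a(\rho)=\sum_{j=1}^n |j\rangle\langle j|\otimes A_{a,j}\rho A_{a,j}^*$, with output space $\mathcal Y=\mathbb C^n\otimes\mathcal X$. Then $\Phi_0,\Phi_1$ are channels (completely positive and trace-preserving) and $$\|\Phi_0-\Phi_1\|_{\rm NE}=\max_\rho\sum_{j=1}^n\|A_{0,j}\rho A_{0,j}^*-A_{1,j}\rho A_{1,j}^*\|_1 ,$$ the maximum being over density operators $\rho$ on $\mathcal X$. If moreover $\langle A_{0,j},A_{1,j}\rangle=0$ for every $j$, then $\|\Phi_0-\Phi_1\|_{\rm LOCC}=\|\Phi_0-\Phi_1\|_\diamond=2$, for every choice of $\mathcal Z$ with $\dim\mathcal Z\ge d$ in the definition of the LOCC norm; in fact, for every such $\mathcal Z$, there are a density operator on $\mathcal X\otimes\mathcal Z$ and a finite-round LOCC measurement on $\mathcal Y\otimes\mathcal Z$ that together discriminate $\Phi_0$ and $\Phi_1$ without error.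 (2) Let $n=d^2-1$, let $W_1,\dots,W_n$ be pairwise orthogonal traceless unitary operators on $\mathcal X$, and put $A_{0,j}=1/\sqrt n$ and $A_{1,j}=W_j/\sqrt n$. These operators satisfy $\sum_j A_{a,j}^*A_{a,j}=1$ for $a=0,1$, and $\|\Phi_0-\Phi_1\|_{\rm LOCC}=\|\Phi_0-\Phi_1\|_\diamond=2$, while $$\|\Phi_0-\Phi_1\|_{\rm NE}=\max_{|\psi\rangle}\frac{2}{d^2-1}\sum_{j=1}^{d^2-1}\sqrt{1-|\langle\psi|W_j|\psi\rangle|^2}\;\le\;2\sqrt{\frac{d}{d+1}}\;<\;2,$$ the maximum being over unit vectors. Equality holds in the first inequality if and only if there is a unit vector $|\psi\rangle$ with $|\langle\psi|W_j|\psi\rangle|^2=1/(d+1)$ for all $j$. (3) For $0\le a,b<d$ let $W_{a,b}$ be the discrete Weyl operator $W_{a,b}|k\rangle=e^{2\pi i bk/d}|k+a \bmod d\rangle$ ($0\le k<d$). The $d^2-1$ operators $W_{a,b}$ with $(a,b)\neq(0,0)$ satisfy the hypotheses of (2). Hence for the corresponding channels $\|\Phi_0-\Phi_1\|_{\rm LOCC}=\|\Phi_0-\Phi_1\|_\diamond=2$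 and $\|\Phi_0-\Phi_1\|_{\rm NE}\le 2\sqrt{d/(d+1)}<2$, and equality $\|\Phi_0-\Phi_1\|_{\rm NE}=2\sqrt{d/(d+1)}$ holds if and only if there is a unit vector $|\psi\rangle$ such that the vectors $W_{a,b}|\psi\rangle$, $0\le a,b<d$, satisfy $|\langle W_{a,b}\psi|W_{a',b'}\psi\rangle|^2=1/(d+1)$ whenever $(a,b)\neq(a',b')$. -/

import Mathlib

open scoped Matrix Kronecker ComplexOrder

noncomputable section

/-- The trace norm `‖X‖₁ = Tr √(X* X)`: the sum of the singular values of `X`. -/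
def traceNorm {α : Type} [Fintype α] [DecidableEq α] (X : Matrix α α ℂ) : ℝ :=
  ∑ i, Real.sqrt ((Matrix.isHermitian_conjTranspose_mul_self X).eigenvalues i)

/-- The Hilbert–Schmidt inner product `⟨X, Y⟩ = Tr (X* Y)`. -/
def hsInner {α β : Type} [Fintype α] [Fintype β] (X Y : Matrix α β ℂ) : ℂ :=
  (Xᴴ * Y).trace

/-- Density operators. -/
def IsDensity {α : Type} [Fintype α] (ρ : Matrix α α ℂ) : Prop :=
  ρ.PosSemidef ∧ ρ.trace = 1

/-- `(Φ ⊗ 𝟙_{L(ℂ^κ)})(M)`: the map `Φ` is applied to each of the blocks of `M` that are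
indexed by pairs of elements of `κ`. -/
def ampliation {α β : Type} (Φ : Matrix α α ℂ →ₗ[ℂ] Matrix β β ℂ) (κ : Type)
    (M : Matrix (α × κ) (α × κ) ℂ) : Matrix (β × κ) (β × κ) ℂ :=
  Matrix.of fun p q => Φ (Matrix.of fun a b => M (a, p.2) (b, q.2)) p.1 q.1

/-- Channels: completely positive and trace-preserving linear maps. -/
def IsChannel {α β : Type} [Fintype α] [Fintype β]
    (Φ : Matrix α α ℂ →ₗ[ℂ] Matrix β β ℂ) : Prop :=
  (∀ (k : ℕ) (M : Matrix (α × Fin k) (α × Fin k) ℂ),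
      M.PosSemidef → (ampliation Φ (Fin k) M).PosSemidef) ∧
    ∀ X : Matrix α α ℂ, (Φ X).trace = X.trace

/-- The binary-valued measurements `{P₀, P₁}` on `ℂ^α ⊗ ℂ^β` that two parties, the first holding
`ℂ^α` and the second holding `ℂ^β`, can implement by local operations and finitely many rounds of
classical communication.

Either the parties stop and announce a guess (`guessZero`, `guessOne`), or one of them performs a
local operation with Kraus operators `K 0, …, K (N - 1)`, whose output space may be any
finite-dimensional space, tells the other party which index has occurred, and they go on with a
protocol that may depend on this index. (A local instrument with several Kraus operators per
outcome is included, since the continuation may ignore a part of the index; so are local and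
shared randomness, by Kraus operators that are multiples of the identity.) -/
inductive IsFiniteLOCC : ∀ {α β : Type} [Fintype α] [DecidableEq α] [Fintype β] [DecidableEq β],
    Matrix (α × β) (α × β) ℂ → Matrix (α × β) (α × β) ℂ → Prop
  | guessZero {α β : Type} [Fintype α] [DecidableEq α] [Fintype β] [DecidableEq β] :
      IsFiniteLOCC (1 : Matrix (α × β) (α × β) ℂ) 0
  | guessOne {α β : Type} [Fintype α] [DecidableEq α] [Fintype β] [DecidableEq β] :
      IsFiniteLOCC 0 (1 : Matrix (α × β) (α × β) ℂ)
  | first {α β α' : Type} [Fintype α] [DecidableEq α] [Fintype β] [DecidableEq β]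
      [Fintype α'] [DecidableEq α'] {N : ℕ} (K : Fin N → Matrix α' α ℂ)
      (hK : ∑ i, (K i)ᴴ * K i = 1) (P Q : Fin N → Matrix (α' × β) (α' × β) ℂ)
      (h : ∀ i, IsFiniteLOCC (P i) (Q i)) :
      IsFiniteLOCC (∑ i, (K i ⊗ₖ (1 : Matrix β β ℂ))ᴴ * P i * (K i ⊗ₖ (1 : Matrix β β ℂ)))
        (∑ i, (K i ⊗ₖ (1 : Matrix β β ℂ))ᴴ * Q i * (K i ⊗ₖ (1 : Matrix β β ℂ)))
  | second {α β β' : Type} [Fintype α] [DecidableEq α] [Fintype β] [DecidableEq β]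
      [Fintype β'] [DecidableEq β'] {N : ℕ} (K : Fin N → Matrix β' β ℂ)
      (hK : ∑ i, (K i)ᴴ * K i = 1) (P Q : Fin N → Matrix (α × β') (α × β') ℂ)
      (h : ∀ i, IsFiniteLOCC (P i) (Q i)) :
      IsFiniteLOCC (∑ i, ((1 : Matrix α α ℂ) ⊗ₖ K i)ᴴ * P i * ((1 : Matrix α α ℂ) ⊗ₖ K i))
        (∑ i, ((1 : Matrix α α ℂ) ⊗ₖ K i)ᴴ * Q i * ((1 : Matrix α α ℂ) ⊗ₖ K i))

/-- The set of LOCC measurements: the closure of the set of the finite-round ones. -/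
def loccMeasurements (α β : Type) [Fintype α] [DecidableEq α] [Fintype β] [DecidableEq β] :
    Set (Matrix (α × β) (α × β) ℂ × Matrix (α × β) (α × β) ℂ) :=
  closure {P | IsFiniteLOCC P.1 P.2}

/-- `‖Φ‖_NE`, the maximum of `‖Φ(ρ)‖₁` over density operators `ρ`
(for Hermiticity-preserving `Φ`). -/
def neNorm {α β : Type} [Fintype α] [Fintype β] [DecidableEq β]
    (Φ : Matrix α α ℂ →ₗ[ℂ] Matrix β β ℂ) : ℝ :=
  sSup {r : ℝ | ∃ ρ : Matrix α α ℂ, IsDensity ρ ∧ r = traceNorm (Φ ρ)}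

/-- The diamond norm, the maximum of `‖(Φ ⊗ 𝟙)(ρ)‖₁` over density operators `ρ` on two copies of
the input space (for Hermiticity-preserving `Φ`). -/
def diamondNorm {α β : Type} [Fintype α] [DecidableEq α] [Fintype β] [DecidableEq β]
    (Φ : Matrix α α ℂ →ₗ[ℂ] Matrix β β ℂ) : ℝ :=
  sSup {r : ℝ | ∃ ρ : Matrix (α × α) (α × α) ℂ, IsDensity ρ ∧ r = traceNorm (ampliation Φ α ρ)}

/-- `‖Φ‖_LOCC` computed with the ancillary space `ℂ^κ` (for Hermiticity-preserving `Φ`): the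
maximum of `⟨P₀ - P₁, (Φ ⊗ 𝟙)(ρ)⟩` over LOCC measurements `{P₀, P₁}` of the output and ancillary
systems and density operators `ρ` of the input and ancillary systems. -/
def loccNorm {α β : Type} [Fintype α] [DecidableEq α] [Fintype β] [DecidableEq β]
    (κ : Type) [Fintype κ] [DecidableEq κ] (Φ : Matrix α α ℂ →ₗ[ℂ] Matrix β β ℂ) : ℝ :=
  sSup {r : ℝ | ∃ P ∈ loccMeasurements β κ, ∃ ρ : Matrix (α × κ) (α × κ) ℂ,
    IsDensity ρ ∧ r = (hsInner (P.1 - P.2) (ampliation Φ κ ρ)).re}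

/-- The flagged map `ρ ↦ ∑ j, |j⟩⟨j| ⊗ A j ρ (A j)*`, for a finite set `ι` of flags. -/
def flaggedChannel {d : ℕ} {ι : Type} [Fintype ι] [DecidableEq ι]
    (A : ι → Matrix (Fin d) (Fin d) ℂ) :
    Matrix (Fin d) (Fin d) ℂ →ₗ[ℂ] Matrix (ι × Fin d) (ι × Fin d) ℂ where
  toFun ρ := ∑ j, Matrix.single j j (1 : ℂ) ⊗ₖ (A j * ρ * (A j)ᴴ)
  map_add' ρ σ := by
    rw [← Finset.sum_add_distrib]
    exact Finset.sum_congr rfl fun j _ => by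
      rw [Matrix.mul_add, Matrix.add_mul, Matrix.kronecker_add]
  map_smul' c ρ := by
    rw [RingHom.id_apply, Finset.smul_sum]
    exact Finset.sum_congr rfl fun j _ => by
      rw [Matrix.mul_smul, Matrix.smul_mul, Matrix.kronecker_smul]

/-- The Kraus operators `W j / √(d² - 1)`. -/
def scaledKraus {d : ℕ} {ι : Type} (W : ι → Matrix (Fin d) (Fin d) ℂ) :
    ι → Matrix (Fin d) (Fin d) ℂ :=
  fun j => ((Real.sqrt ((d : ℝ) ^ 2 - 1))⁻¹ : ℝ) • W j

/-- `W` is a family of `d² - 1` traceless unitary operators on `ℂ^d` that are pairwise orthogonal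
for the Hilbert–Schmidt inner product. -/
def IsTracelessUnitaryFamily {d : ℕ} {ι : Type} [Fintype ι]
    (W : ι → Matrix (Fin d) (Fin d) ℂ) : Prop :=
  Fintype.card ι + 1 = d ^ 2 ∧
    (∀ j, W j ∈ Matrix.unitaryGroup (Fin d) ℂ) ∧
    (∀ j, (W j).trace = 0) ∧
    ∀ j k, j ≠ k → hsInner (W j) (W k) = 0

/-- The discrete Weyl operator with parameters `p = (a, b)`, which maps `|k⟩` to
`exp (2 π i b k / d) |k + a mod d⟩`. -/
def weyl {d : ℕ} (p : Fin d × Fin d) : Matrix (Fin d) (Fin d) ℂ :=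
  Matrix.of fun i k => if (i : ℕ) = ((k : ℕ) + (p.1 : ℕ)) % d then
    Complex.exp (2 * Real.pi * Complex.I * (p.2 : ℕ) * (k : ℕ) / d) else 0

/-- The parameters `(a, b) ≠ (0, 0)`, which index the non-identity Weyl operators. -/
abbrev WeylIndex (d : ℕ) : Type :=
  {p : Fin d × Fin d // ¬((p.1 : ℕ) = 0 ∧ (p.2 : ℕ) = 0)}

end

/-! Perfect discrimination rests on one identity. Feed half of a maximally entangled state into the
channel; if the flag is `j` and the output is contracted with a vector `x`, the ancilla is left in
one of two vectors (one per channel), whose inner product is `⟨x, A₁ⱼ A₀ⱼ* x⟩ / d`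
(`star_dotProduct_conditional`). Orthogonality of the Kraus operators says that `A₁ⱼ A₀ⱼ*` is
traceless, and a traceless matrix has a tight frame of vectors on which its quadratic form vanishes
(`exists_isotropic_frame`). So the output holder reads the flag, measures that frame and announces
the outcome; the ancilla holder then separates two orthogonal vectors by a projection. No
measurement, local or not, exceeds the value 2.

Without an ancilla, convexity and compactness put the maximum at a pure state `ψ`. For unitary Kraus
operators each flag contributes the trace norm of a difference of two pure states, `2 √(1 - |⟨ψ, Wⱼ
ψ⟩|²)` up to the weight `1 / (d² - 1)`. The identity and the `Wⱼ` form an orthogonal basis of the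
matrices, so Parseval (`sum_norm_sq`) fixes `∑ |⟨ψ, Wⱼ ψ⟩|² = d - 1`. Concavity of the square root
(`sum_sqrt_le_card_mul`) gives the bound, with equality exactly when all terms equal `1 / (d + 1)`.
For Weyl operators, `W_p* W_q` is a phase times `W_{q-p}`, which turns this condition into
equiangularity of the orbit of `ψ`. -/

open Matrix

/-! ### Spectral factorization and positivity of traces. -/

namespace Matrix

variable {α : Type} [Fintype α] [DecidableEq α]

/-- The spectral theorem, as an explicit factorization. -/
theorem IsHermitian.exists_eq_mul_diagonal_mul {X : Matrix α α ℂ} (hX : X.IsHermitian) :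
    ∃ (U : Matrix α α ℂ) (l : α → ℝ), U * Uᴴ = 1 ∧ Uᴴ * U = 1 ∧
      X = U * diagonal (fun i => (l i : ℂ)) * Uᴴ := by
  refine ⟨hX.eigenvectorUnitary, hX.eigenvalues, ?_, ?_, ?_⟩
  · exact Unitary.coe_mul_star_self hX.eigenvectorUnitary
  · exact Unitary.coe_star_mul_self hX.eigenvectorUnitary
  · exact hX.spectral_theorem

open scoped MatrixOrder in
/-- The trace of the product of two positive semidefinite matrices is nonnegative. -/
theorem PosSemidef.trace_mul_nonneg {P X : Matrix α α ℂ} (hP : P.PosSemidef)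
    (hX : X.PosSemidef) : 0 ≤ (P * X).trace := by
  obtain ⟨B, rfl⟩ := (CStarAlgebra.nonneg_iff_eq_star_mul_self (a := X)).1 hX.nonneg
  rw [star_eq_conjTranspose, ← Matrix.mul_assoc, trace_mul_comm, ← Matrix.mul_assoc]
  exact (hP.mul_mul_conjTranspose_same B).trace_nonneg

end Matrix

/-! ### The trace norm: duality with measurements, continuity, special values. -/

section

variable {α : Type} [Fintype α] [DecidableEq α]

/-- The characteristic polynomial determines the eigenvalues as a multiset, so any splitting of it
into linear factors computes the trace norm. -/
theorem traceNorm_eq_sum_sqrt {β : Type} [Fintype β] {X : Matrix α α ℂ} {f : β → ℝ}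
    (h : (Xᴴ * X).charpoly = ∏ i, (Polynomial.X - Polynomial.C (f i : ℂ))) :
    traceNorm X = ∑ i, √(f i) := by
  have h1 := (isHermitian_conjTranspose_mul_self X).roots_charpoly_eq_eigenvalues
  rw [h, Polynomial.roots_prod _ _ (by
    simp [Finset.prod_ne_zero_iff, Polynomial.X_sub_C_ne_zero])] at h1
  simp only [Polynomial.roots_X_sub_C, Multiset.bind_singleton] at h1
  have h2 := congrArg (fun s => (s.map (fun z : ℂ => √z.re)).sum) h1
  simp only [Multiset.map_map, Function.comp_def, Complex.ofReal_re] at h2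
  rw [traceNorm]
  simpa using h2.symm

theorem traceNorm_eq_sum_abs {X U : Matrix α α ℂ} {l : α → ℝ} (h1 : Uᴴ * U = 1)
    (hX : X = U * diagonal (fun i => (l i : ℂ)) * Uᴴ) :
    traceNorm X = ∑ i, |l i| := by
  simp only [← Real.sqrt_sq_eq_abs]
  apply traceNorm_eq_sum_sqrt
  have h2 : Xᴴ * X = U * diagonal (fun i => ((l i ^ 2 : ℝ) : ℂ)) * Uᴴ := by
    have h3 : Xᴴ = X := by
      rw [hX]
      simp [conjTranspose_mul, Matrix.mul_assoc, diagonal_conjTranspose, Pi.star_def]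
    rw [h3, hX]
    calc _ = U * diagonal (fun i => (l i : ℂ)) * (Uᴴ * U) * diagonal (fun i => (l i : ℂ)) * Uᴴ := by
          simp only [Matrix.mul_assoc]
      _ = _ := by
          rw [h1, Matrix.mul_one, Matrix.mul_assoc U, diagonal_mul_diagonal]
          simp [pow_two]
  rw [h2, charpoly_mul_comm, ← Matrix.mul_assoc, h1, Matrix.one_mul, charpoly_diagonal]

/-- In an eigenbasis of `X` the trace is `∑ (pᵢ - qᵢ) lᵢ` with `pᵢ, qᵢ ≥ 0` and `pᵢ + qᵢ = 1`. This
is one half of the Holevo–Helstrom duality. -/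
theorem re_trace_mul_le_traceNorm {X P Q : Matrix α α ℂ} (hX : X.IsHermitian)
    (hP : P.PosSemidef) (hQ : Q.PosSemidef) (hPQ : P + Q = 1) :
    ((P - Q) * X).trace.re ≤ traceNorm X := by
  obtain ⟨U, l, h1, h2, hU⟩ := hX.exists_eq_mul_diagonal_mul
  rw [traceNorm_eq_sum_abs h2 hU]
  have hP' := hP.conjTranspose_mul_mul_same U
  have hQ' := hQ.conjTranspose_mul_mul_same U
  have hs : Uᴴ * P * U + Uᴴ * Q * U = 1 := by
    rw [← Matrix.add_mul, ← Matrix.mul_add, hPQ, Matrix.mul_one, h2]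
  have ht : ((P - Q) * X).trace
      = ((Uᴴ * P * U - Uᴴ * Q * U) * diagonal (fun i => (l i : ℂ))).trace := by
    rw [hU, ← Matrix.mul_assoc, ← Matrix.mul_assoc, trace_mul_comm, ← Matrix.sub_mul,
      ← Matrix.mul_sub]
    simp only [Matrix.mul_assoc]
  rw [ht, trace, Complex.re_sum]
  refine Finset.sum_le_sum fun i _ => ?_
  have hp := Complex.nonneg_iff.1 (hP'.diag_nonneg (i := i))
  have hq := Complex.nonneg_iff.1 (hQ'.diag_nonneg (i := i))
  have hi := congrArg Complex.re (congrFun (congrFun hs i) i)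
  simp only [Matrix.add_apply, Complex.add_re, one_apply_eq, Complex.one_re] at hi
  simp only [diag_apply, mul_diagonal, Matrix.sub_apply, Complex.re_mul_ofReal, Complex.sub_re]
  refine (le_abs_self _).trans ?_
  rw [abs_mul]
  exact mul_le_of_le_one_left (abs_nonneg _) (abs_le.2 ⟨by linarith, by linarith⟩)

/-- The other half of the duality: project onto the nonnegative and the negative eigenspaces.
Together the halves make the trace norm a maximum of linear functionals, hence convex. -/
theorem exists_traceNorm_eq {X : Matrix α α ℂ} (hX : X.IsHermitian) :
    ∃ P Q : Matrix α α ℂ, P.PosSemidef ∧ Q.PosSemidef ∧ P + Q = 1 ∧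
      traceNorm X = ((P - Q) * X).trace.re := by
  obtain ⟨U, l, h1, h2, hU⟩ := hX.exists_eq_mul_diagonal_mul
  refine ⟨U * diagonal (fun i => if 0 ≤ l i then 1 else 0) * Uᴴ,
    U * diagonal (fun i => if 0 ≤ l i then 0 else 1) * Uᴴ, ?_, ?_, ?_, ?_⟩
  · refine PosSemidef.mul_mul_conjTranspose_same (PosSemidef.diagonal fun i => ?_) U
    simp only [Pi.zero_apply]; split_ifs <;> simp
  · refine PosSemidef.mul_mul_conjTranspose_same (PosSemidef.diagonal fun i => ?_) U
    simp only [Pi.zero_apply]; split_ifs <;> simp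
  · rw [← Matrix.add_mul, ← Matrix.mul_add, diagonal_add]
    have : (fun i => (if 0 ≤ l i then (1 : ℂ) else 0) + if 0 ≤ l i then 0 else 1) = fun _ => 1 := by
      funext i; split_ifs <;> simp
    rw [this, diagonal_one, Matrix.mul_one, h1]
  · rw [traceNorm_eq_sum_abs h2 hU, hU, ← Matrix.sub_mul, ← Matrix.mul_sub, diagonal_sub]
    have : ∀ D E : Matrix α α ℂ, (U * D * Uᴴ * (U * E * Uᴴ)).trace = (D * E).trace := by
      intro D E
      calc _ = (U * D * (Uᴴ * U) * E * Uᴴ).trace := by simp only [Matrix.mul_assoc]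
        _ = (D * E * (Uᴴ * U)).trace := by
          rw [h2, Matrix.mul_one, Matrix.mul_one, trace_mul_comm, ← Matrix.mul_assoc,
            ← Matrix.mul_assoc, h2, Matrix.one_mul]
        _ = _ := by rw [h2, Matrix.mul_one]
    rw [this, diagonal_mul_diagonal, trace_diagonal, Complex.re_sum]
    refine Finset.sum_congr rfl fun i _ => ?_
    split_ifs with h
    · simp [abs_of_nonneg h]
    · simp [abs_of_neg (not_le.1 h)]

theorem traceNorm_add_le {X Y : Matrix α α ℂ} (hX : X.IsHermitian) (hY : Y.IsHermitian) :
    traceNorm (X + Y) ≤ traceNorm X + traceNorm Y := by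
  obtain ⟨P, Q, hP, hQ, hPQ, h⟩ := exists_traceNorm_eq (hX.add hY)
  rw [h, Matrix.mul_add, trace_add, Complex.add_re]
  exact add_le_add (re_trace_mul_le_traceNorm hX hP hQ hPQ)
    (re_trace_mul_le_traceNorm hY hP hQ hPQ)

theorem traceNorm_smul_le {X : Matrix α α ℂ} (hX : X.IsHermitian) {c : ℝ} (hc : 0 ≤ c) :
    traceNorm ((c : ℂ) • X) ≤ c * traceNorm X := by
  have hcX : ((c : ℂ) • X).IsHermitian := by
    rw [IsHermitian, conjTranspose_smul, hX.eq]; simp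
  obtain ⟨P, Q, hP, hQ, hPQ, h⟩ := exists_traceNorm_eq hcX
  rw [h, Matrix.mul_smul, trace_smul, smul_eq_mul, Complex.re_ofReal_mul]
  exact mul_le_mul_of_nonneg_left (re_trace_mul_le_traceNorm hX hP hQ hPQ) hc

theorem traceNorm_zero : traceNorm (0 : Matrix α α ℂ) = 0 := by
  simpa using traceNorm_eq_sum_abs (X := (0 : Matrix α α ℂ)) (U := 1) (l := 0) (by simp)
    (by simp)

theorem traceNorm_sum_smul_le {ι : Type} (s : Finset ι) {X : ι → Matrix α α ℂ}
    (hX : ∀ i, (X i).IsHermitian) {c : ι → ℝ} (hc : ∀ i, 0 ≤ c i) :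
    traceNorm (∑ i ∈ s, (c i : ℂ) • X i) ≤ ∑ i ∈ s, c i * traceNorm (X i) := by
  classical
  have hcX : ∀ i, ((c i : ℂ) • X i).IsHermitian := fun i => by
    rw [IsHermitian, conjTranspose_smul, (hX i).eq]; simp
  induction s using Finset.induction_on with
  | empty => simp [traceNorm_zero]
  | insert i s hi ih =>
    rw [Finset.sum_insert hi, Finset.sum_insert hi]
    refine (traceNorm_add_le (hcX i) (isSelfAdjoint_sum s fun i _ => hcX i)).trans ?_
    exact add_le_add (traceNorm_smul_le (hX i) (hc i)) ih

/-- `(P + Q)(ρ + σ) - (P - Q)(ρ - σ) = 2 P σ + 2 Q ρ` has nonnegative trace. -/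
theorem re_trace_le_two {P Q ρ σ : Matrix α α ℂ} (hP : P.PosSemidef) (hQ : Q.PosSemidef)
    (hPQ : P + Q = 1) (hρ : IsDensity ρ) (hσ : IsDensity σ) :
    ((P - Q) * (ρ - σ)).trace.re ≤ 2 := by
  have h1 := (Complex.nonneg_iff.1 (hP.trace_mul_nonneg hσ.1)).1
  have h2 := (Complex.nonneg_iff.1 (hQ.trace_mul_nonneg hρ.1)).1
  have h3 : ((P + Q) * (ρ + σ)).trace.re = 2 := by
    rw [hPQ, Matrix.one_mul, trace_add, hρ.2, hσ.2]; norm_num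
  simp only [Matrix.add_mul, Matrix.mul_add, Matrix.sub_mul, Matrix.mul_sub, trace_add, trace_sub,
    Complex.add_re, Complex.sub_re] at h3 ⊢
  linarith

theorem traceNorm_sub_le_two {ρ σ : Matrix α α ℂ} (hρ : IsDensity ρ) (hσ : IsDensity σ) :
    traceNorm (ρ - σ) ≤ 2 := by
  obtain ⟨P, Q, hP, hQ, hPQ, h⟩ := exists_traceNorm_eq (hρ.1.1.sub hσ.1.1)
  rw [h]
  exact re_trace_le_two hP hQ hPQ hρ hσ

/-- A crude comparison with the Hilbert–Schmidt norm, which bounds every singular value; it serves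
only to prove continuity. -/
theorem traceNorm_le_card_mul_sqrt (X : Matrix α α ℂ) :
    traceNorm X ≤ Fintype.card α * √((Xᴴ * X).trace.re) := by
  set hY := isHermitian_conjTranspose_mul_self X
  have h0 : ∀ i, 0 ≤ hY.eigenvalues i := (posSemidef_conjTranspose_mul_self X).eigenvalues_nonneg
  have h1 : (Xᴴ * X).trace.re = ∑ i, hY.eigenvalues i := by
    rw [hY.trace_eq_sum_eigenvalues]; simp
  rw [traceNorm, h1]
  calc _ ≤ ∑ _i : α, √(∑ i, hY.eigenvalues i) := Finset.sum_le_sum fun i _ =>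
        Real.sqrt_le_sqrt (Finset.single_le_sum (fun j _ => h0 j) (Finset.mem_univ i))
    _ = _ := by simp

theorem abs_traceNorm_sub_le {X Y : Matrix α α ℂ} (hX : X.IsHermitian) (hY : Y.IsHermitian) :
    |traceNorm X - traceNorm Y| ≤ Fintype.card α * √(((X - Y)ᴴ * (X - Y)).trace.re) := by
  rw [abs_le]
  constructor
  · have h1 := traceNorm_add_le hX (hY.sub hX)
    have h2 := traceNorm_le_card_mul_sqrt (Y - X)
    rw [add_sub_cancel] at h1
    rw [← neg_sub Y X, conjTranspose_neg, neg_mul_neg]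
    linarith
  · have h1 := traceNorm_add_le hY (hX.sub hY)
    have h2 := traceNorm_le_card_mul_sqrt (X - Y)
    rw [add_sub_cancel] at h1
    linarith

theorem Continuous.traceNorm_of_isHermitian {T : Type} [TopologicalSpace T] {f : T → Matrix α α ℂ}
    (hf : Continuous f) (hH : ∀ t, (f t).IsHermitian) : Continuous fun t => traceNorm (f t) := by
  rw [continuous_iff_continuousAt]
  intro t
  rw [ContinuousAt, tendsto_iff_norm_sub_tendsto_zero]
  refine squeeze_zero (fun _ => norm_nonneg _) (fun s => abs_traceNorm_sub_le (hH s) (hH t)) ?_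
  have h1 : Continuous fun s =>
      (Fintype.card α : ℝ) * √(((f s - f t)ᴴ * (f s - f t)).trace.re) := by
    fun_prop
  simpa using h1.tendsto t

/-- The trace norm of a matrix `X` for which `X* X` is a multiple of a projection of rank two. -/
theorem traceNorm_eq_two_mul {X : Matrix α α ℂ} {r : ℝ} (hr : 0 ≤ r)
    (h2 : Xᴴ * X * (Xᴴ * X) = ((r ^ 2 : ℝ) : ℂ) • (Xᴴ * X))
    (ht : (Xᴴ * X).trace = ((2 * r ^ 2 : ℝ) : ℂ)) : traceNorm X = 2 * r := by
  set hY := isHermitian_conjTranspose_mul_self X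
  have h0 : ∀ i, 0 ≤ hY.eigenvalues i := (posSemidef_conjTranspose_mul_self X).eigenvalues_nonneg
  have hsum : ∑ i, hY.eigenvalues i = 2 * r ^ 2 := by
    rw [hY.trace_eq_sum_eigenvalues] at ht
    apply Complex.ofReal_injective
    simpa using ht
  -- Every eigenvalue of `X* X` is `0` or `r²`, so for `r > 0` its square root is the eigenvalue
  -- divided by `r`, and the trace gives the sum.
  have hev : ∀ i, hY.eigenvalues i * hY.eigenvalues i = r ^ 2 * hY.eigenvalues i := by
    intro i
    set v : α → ℂ := ⇑(hY.eigenvectorBasis i) with hv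
    have h3 : (Xᴴ * X) *ᵥ v = hY.eigenvalues i • v := hY.mulVec_eigenvectorBasis i
    have h4 := congrArg (· *ᵥ v) h2
    simp only [← mulVec_mulVec, smul_mulVec] at h4 h3
    rw [h3, mulVec_smul, mulVec_smul, h3, ← Complex.coe_smul, ← Complex.coe_smul, smul_smul,
      smul_smul] at h4
    have hv0 : v ≠ 0 := by
      intro h
      apply hY.eigenvectorBasis.toBasis.ne_zero i
      ext j
      simpa using congrFun h j
    have := smul_left_injective ℂ hv0 h4
    exact_mod_cast this
  rcases hr.eq_or_lt with rfl | hr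
  · have h5 : ∀ i, hY.eigenvalues i = 0 := fun i => by simpa using hev i
    rw [traceNorm]
    simp [h5]
  · have h5 : ∀ i, √(hY.eigenvalues i) = hY.eigenvalues i / r := by
      intro i
      rcases (h0 i).eq_or_lt with h | h
      · simp [← h]
      · have := mul_right_cancel₀ h.ne' (hev i)
        rw [this, Real.sqrt_sq hr.le]
        field_simp
    rw [traceNorm, Finset.sum_congr rfl fun i _ => h5 i, ← Finset.sum_div, hsum]
    field_simp

/-- Cauchy–Schwarz: `1 - |c|²` is the squared norm of `u` minus its projection onto `v`. -/
theorem norm_dotProduct_sq_le_one {α : Type} [Fintype α] {u v : α → ℂ} (hu : star u ⬝ᵥ u = 1)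
    (hv : star v ⬝ᵥ v = 1) : ‖star u ⬝ᵥ v‖ ^ 2 ≤ 1 := by
  set c := star u ⬝ᵥ v with hc
  have hc' : star v ⬝ᵥ u = star c := by
    rw [hc, ← star_dotProduct_star, star_star]
  have hcc : c * star c = ((‖c‖ ^ 2 : ℝ) : ℂ) := by
    rw [Complex.star_def, Complex.mul_conj, Complex.normSq_eq_norm_sq]
  have h1 := dotProduct_star_self_nonneg (u - star c • v)
  have h2 : star (u - star c • v) ⬝ᵥ (u - star c • v) = ((1 - ‖c‖ ^ 2 : ℝ) : ℂ) := by
    simp only [star_sub, star_smul, star_star, sub_dotProduct, dotProduct_sub, smul_dotProduct,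
      dotProduct_smul, hu, hv, hc', ← hc, smul_eq_mul]
    push_cast at hcc ⊢
    linear_combination (-1 : ℂ) * hcc
  rw [h2] at h1
  have := Complex.zero_le_real.1 h1
  linarith

/-- The trace norm of a difference of two pure states. -/
theorem traceNorm_smul_vecMulVec_sub {u v : α → ℂ} (hu : star u ⬝ᵥ u = 1) (hv : star v ⬝ᵥ v = 1)
    {t : ℝ} (ht : 0 ≤ t) :
    traceNorm ((t : ℂ) • (vecMulVec u (star u) - vecMulVec v (star v)))
      = 2 * (t * √(1 - ‖star u ⬝ᵥ v‖ ^ 2)) := by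
  set c := star u ⬝ᵥ v with hc
  have hc' : star v ⬝ᵥ u = star c := by
    rw [hc, ← star_dotProduct_star, star_star]
  have hcc : c * star c = ((‖c‖ ^ 2 : ℝ) : ℂ) := by
    rw [Complex.star_def, Complex.mul_conj, Complex.normSq_eq_norm_sq]
  have hc1 : ‖c‖ ^ 2 ≤ 1 := norm_dotProduct_sq_le_one hu hv
  have hs : ((√(1 - ‖c‖ ^ 2) ^ 2 : ℝ) : ℂ) = 1 - c * star c := by
    rw [Real.sq_sqrt (by linarith), hcc]; push_cast; ring
  have hY : ((t : ℂ) • (vecMulVec u (star u) - vecMulVec v (star v)))ᴴ *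
      ((t : ℂ) • (vecMulVec u (star u) - vecMulVec v (star v))) =
      (t ^ 2 : ℂ) • (vecMulVec u (star u) + vecMulVec v (star v) - c • vecMulVec u (star v)
        - star c • vecMulVec v (star u)) := by
    simp only [conjTranspose_smul, conjTranspose_sub, conjTranspose_vecMulVec, star_star,
      Matrix.smul_mul, Matrix.mul_smul, Matrix.sub_mul, Matrix.mul_sub, vecMulVec_mul_vecMulVec,
      hu, hv, hc', ← hc, Complex.star_def, Complex.conj_ofReal, one_smul,
      vecMulVec_smul]
    module
  -- With `c = ⟨u, v⟩`, the square of `uu* - vv*` acts on the span of `u` and `v` as multiplication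
  -- by `1 - |c|²`, and its trace is `2 (1 - |c|²)`.
  apply traceNorm_eq_two_mul (by positivity)
  · rw [hY]
    have : (((t * √(1 - ‖c‖ ^ 2)) ^ 2 : ℝ) : ℂ) = t ^ 2 * (1 - c * star c) := by
      rw [← hs]; push_cast; ring
    rw [this]
    simp only [Matrix.smul_mul, Matrix.mul_smul, Matrix.sub_mul, Matrix.mul_sub, Matrix.add_mul,
      Matrix.mul_add, vecMulVec_mul_vecMulVec, hu, hv, hc', ← hc, one_smul, vecMulVec_smul]
    module
  · rw [hY]
    have e1 : u ⬝ᵥ star u = 1 := by rw [dotProduct_comm, hu]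
    have e2 : v ⬝ᵥ star v = 1 := by rw [dotProduct_comm, hv]
    have e3 : u ⬝ᵥ star v = star c := by rw [dotProduct_comm, hc']
    have e4 : v ⬝ᵥ star u = c := by rw [dotProduct_comm, hc]
    simp only [trace_smul, trace_sub, trace_add, trace_vecMulVec, e1, e2, e3, e4, smul_eq_mul]
    have : ((2 * (t * √(1 - ‖c‖ ^ 2)) ^ 2 : ℝ) : ℂ) = 2 * t ^ 2 * (1 - c * star c) := by
      rw [← hs]; push_cast; ring
    rw [this]; ring

/-- `blockDiagonal` puts the block index second, the flag comes first; hence the swap. -/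
theorem sum_single_kronecker_eq_blockDiagonal {ι β : Type} [Fintype ι] [DecidableEq ι]
    (X : ι → Matrix β β ℂ) :
    ∑ j, single j j (1 : ℂ) ⊗ₖ X j
      = (blockDiagonal X).submatrix (Equiv.prodComm ι β) (Equiv.prodComm ι β) := by
  ext ⟨i, a⟩ ⟨j, b⟩
  simp only [Matrix.sum_apply, kroneckerMap_apply, single_apply, submatrix_apply,
    Equiv.prodComm_apply, Prod.swap, blockDiagonal_apply]
  rcases eq_or_ne i j with rfl | h
  · simp
  · rw [if_neg h, Finset.sum_eq_zero]
    rintro k -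
    rw [if_neg (by rintro ⟨rfl, rfl⟩; exact h rfl), zero_mul]

/-- The characteristic polynomial of a block diagonal matrix is the product of those of its blocks,
so the singular values of the blocks are collected with multiplicity. -/
theorem traceNorm_sum_single_kronecker {ι : Type} [Fintype ι] [DecidableEq ι]
    (X : ι → Matrix α α ℂ) :
    traceNorm (∑ j, single j j (1 : ℂ) ⊗ₖ X j) = ∑ j, traceNorm (X j) := by
  have h1 : ∑ j, traceNorm (X j) = ∑ p : ι × α,
      √((isHermitian_conjTranspose_mul_self (X p.1)).eigenvalues p.2) := by
    rw [Fintype.sum_prod_type]; rfl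
  rw [h1]
  apply traceNorm_eq_sum_sqrt
  rw [sum_single_kronecker_eq_blockDiagonal, conjTranspose_submatrix,
    submatrix_mul_equiv _ _ _ (Equiv.prodComm ι α) _, blockDiagonal_conjTranspose,
    ← blockDiagonal_mul]
  have h2 := charpoly_reindex (Equiv.prodComm α ι) (blockDiagonal fun k => (X k)ᴴ * X k)
  rw [reindex_apply] at h2
  refine h2.trans ?_
  have h3 : (blockDiagonal fun k => (X k)ᴴ * X k).charmatrix
      = blockDiagonal fun k => ((X k)ᴴ * X k).charmatrix := by
    ext ⟨a, i⟩ ⟨b, j⟩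
    simp only [charmatrix_apply, blockDiagonal_apply, diagonal_apply, Prod.mk.injEq]
    split_ifs <;> simp_all
  rw [Matrix.charpoly, h3, det_blockDiagonal, Fintype.prod_prod_type]
  exact Finset.prod_congr rfl fun i _ =>
    (isHermitian_conjTranspose_mul_self (X i)).charpoly_eq

end

/-! ### Maps in Kraus form and their ampliations. -/

section Kraus

variable {ι α β κ : Type} [Fintype ι] [Fintype κ] [DecidableEq κ]

theorem posSemidef_sum_mul_mul_conjTranspose [Fintype α] [Fintype β] (K : ι → Matrix β α ℂ)
    {M : Matrix α α ℂ} (hM : M.PosSemidef) : (∑ j, K j * M * (K j)ᴴ).PosSemidef :=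
  posSemidef_sum _ fun j _ => hM.mul_mul_conjTranspose_same (K j)

theorem trace_sum_mul_mul_conjTranspose [Fintype α] [DecidableEq α] [Fintype β]
    {K : ι → Matrix β α ℂ} (hK : ∑ j, (K j)ᴴ * K j = 1)
    (M : Matrix α α ℂ) : (∑ j, K j * M * (K j)ᴴ).trace = M.trace := by
  have : ∀ j, (K j * M * (K j)ᴴ).trace = ((K j)ᴴ * K j * M).trace := fun j => by
    rw [trace_mul_comm, ← Matrix.mul_assoc]
  rw [trace_sum, Finset.sum_congr rfl fun j _ => this j, ← trace_sum, ← Matrix.sum_mul, hK,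
    Matrix.one_mul]

theorem sum_kronecker_one [DecidableEq α] [Fintype β] {K : ι → Matrix β α ℂ}
    (hK : ∑ j, (K j)ᴴ * K j = 1) :
    ∑ j, (K j ⊗ₖ (1 : Matrix κ κ ℂ))ᴴ * (K j ⊗ₖ (1 : Matrix κ κ ℂ)) = 1 := by
  classical
  have : ∀ j, (K j ⊗ₖ (1 : Matrix κ κ ℂ))ᴴ * (K j ⊗ₖ (1 : Matrix κ κ ℂ))
      = ((K j)ᴴ * K j) ⊗ₖ (1 : Matrix κ κ ℂ) := fun j => by
    rw [conjTranspose_kronecker, ← mul_kronecker_mul, conjTranspose_one, Matrix.mul_one]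
  have h : ∀ s : Finset ι, ∑ j ∈ s, ((K j)ᴴ * K j) ⊗ₖ (1 : Matrix κ κ ℂ)
      = (∑ j ∈ s, (K j)ᴴ * K j) ⊗ₖ (1 : Matrix κ κ ℂ) := fun s => by
    induction s using Finset.induction_on with
    | empty => simp
    | insert i s hi ih => rw [Finset.sum_insert hi, Finset.sum_insert hi, add_kronecker, ih]
  rw [Finset.sum_congr rfl fun j _ => this j, h, hK, one_kronecker_one]

theorem sum_one_kronecker [DecidableEq α] [Fintype β] {K : ι → Matrix β α ℂ}
    (hK : ∑ j, (K j)ᴴ * K j = 1) :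
    ∑ j, ((1 : Matrix κ κ ℂ) ⊗ₖ K j)ᴴ * ((1 : Matrix κ κ ℂ) ⊗ₖ K j) = 1 := by
  classical
  have : ∀ j, ((1 : Matrix κ κ ℂ) ⊗ₖ K j)ᴴ * ((1 : Matrix κ κ ℂ) ⊗ₖ K j)
      = (1 : Matrix κ κ ℂ) ⊗ₖ ((K j)ᴴ * K j) := fun j => by
    rw [conjTranspose_kronecker, ← mul_kronecker_mul, conjTranspose_one, Matrix.mul_one]
  have h : ∀ s : Finset ι, ∑ j ∈ s, (1 : Matrix κ κ ℂ) ⊗ₖ ((K j)ᴴ * K j)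
      = (1 : Matrix κ κ ℂ) ⊗ₖ (∑ j ∈ s, (K j)ᴴ * K j) := fun s => by
    induction s using Finset.induction_on with
    | empty => simp
    | insert i s hi ih => rw [Finset.sum_insert hi, Finset.sum_insert hi, kronecker_add, ih]
  rw [Finset.sum_congr rfl fun j _ => this j, h, hK, one_kronecker_one]

theorem ampliation_eq_sum [Fintype α] {Φ : Matrix α α ℂ →ₗ[ℂ] Matrix β β ℂ} {K : ι → Matrix β α ℂ}
    (h : ∀ M, Φ M = ∑ j, K j * M * (K j)ᴴ) (M : Matrix (α × κ) (α × κ) ℂ) :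
    ampliation Φ κ M
      = ∑ j, (K j ⊗ₖ (1 : Matrix κ κ ℂ)) * M * (K j ⊗ₖ (1 : Matrix κ κ ℂ))ᴴ := by
  ext ⟨b, z⟩ ⟨b', z'⟩
  simp only [ampliation, of_apply, h, Matrix.sum_apply]
  refine Finset.sum_congr rfl fun j _ => ?_
  simp [Matrix.mul_apply, Fintype.sum_prod_type, kroneckerMap_apply, one_apply, apply_ite,
    Finset.sum_ite_eq]

end Kraus

/-! ### Flagged channels. -/

section Flagged

variable {d : ℕ} {ι : Type} [Fintype ι] [DecidableEq ι]

/-- The Kraus operator `|j⟩ ⊗ A j` of a flagged channel. -/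
def flaggedKraus (A : ι → Matrix (Fin d) (Fin d) ℂ) (j : ι) : Matrix (ι × Fin d) (Fin d) ℂ :=
  of fun p b => if p.1 = j then A j p.2 b else 0

theorem flaggedChannel_apply (A : ι → Matrix (Fin d) (Fin d) ℂ) (M : Matrix (Fin d) (Fin d) ℂ) :
    flaggedChannel A M = ∑ j, single j j (1 : ℂ) ⊗ₖ (A j * M * (A j)ᴴ) := rfl

theorem flaggedChannel_eq_sum (A : ι → Matrix (Fin d) (Fin d) ℂ) (M : Matrix (Fin d) (Fin d) ℂ) :
    flaggedChannel A M = ∑ j, flaggedKraus A j * M * (flaggedKraus A j)ᴴ := by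
  rw [flaggedChannel_apply]
  refine Finset.sum_congr rfl fun j _ => ?_
  ext ⟨i, a⟩ ⟨i', b⟩
  simp only [kroneckerMap_apply, single_apply, flaggedKraus, Matrix.mul_apply, of_apply,
    conjTranspose_apply, eq_comm (a := j)]
  by_cases h : i = j <;> by_cases h' : i' = j <;> simp [h, h']

theorem sum_flaggedKraus {A : ι → Matrix (Fin d) (Fin d) ℂ} (hA : ∑ j, (A j)ᴴ * A j = 1) :
    ∑ j, (flaggedKraus A j)ᴴ * flaggedKraus A j = 1 := by
  rw [← hA]
  refine Finset.sum_congr rfl fun j _ => ?_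
  ext a b
  simp [flaggedKraus, Matrix.mul_apply, Fintype.sum_prod_type_right, apply_ite]

theorem isChannel_flaggedChannel {A : ι → Matrix (Fin d) (Fin d) ℂ}
    (hA : ∑ j, (A j)ᴴ * A j = 1) : IsChannel (flaggedChannel A) := by
  refine ⟨fun k M hM => ?_, fun X => ?_⟩
  · rw [ampliation_eq_sum (flaggedChannel_eq_sum A)]
    exact posSemidef_sum_mul_mul_conjTranspose _ hM
  · rw [flaggedChannel_eq_sum, trace_sum_mul_mul_conjTranspose (sum_flaggedKraus hA)]

theorem isDensity_ampliation_flaggedChannel {A : ι → Matrix (Fin d) (Fin d) ℂ}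
    (hA : ∑ j, (A j)ᴴ * A j = 1) {κ : Type} [Fintype κ] [DecidableEq κ]
    {ρ : Matrix (Fin d × κ) (Fin d × κ) ℂ} (hρ : IsDensity ρ) :
    IsDensity (ampliation (flaggedChannel A) κ ρ) := by
  rw [ampliation_eq_sum (flaggedChannel_eq_sum A)]
  refine ⟨posSemidef_sum_mul_mul_conjTranspose _ hρ.1, ?_⟩
  rw [trace_sum_mul_mul_conjTranspose (sum_kronecker_one (sum_flaggedKraus hA)), hρ.2]

theorem isHermitian_flaggedChannel (A : ι → Matrix (Fin d) (Fin d) ℂ)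
    {M : Matrix (Fin d) (Fin d) ℂ} (hM : M.IsHermitian) : (flaggedChannel A M).IsHermitian := by
  rw [flaggedChannel_eq_sum]
  exact isSelfAdjoint_sum _ fun j _ => isHermitian_mul_mul_conjTranspose _ hM

theorem flaggedChannel_sub_apply (A B : ι → Matrix (Fin d) (Fin d) ℂ)
    (M : Matrix (Fin d) (Fin d) ℂ) :
    (flaggedChannel A - flaggedChannel B) M
      = ∑ j, single j j (1 : ℂ) ⊗ₖ (A j * M * (A j)ᴴ - B j * M * (B j)ᴴ) := by
  rw [LinearMap.sub_apply, flaggedChannel_apply, flaggedChannel_apply, ← Finset.sum_sub_distrib]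
  exact Finset.sum_congr rfl fun j _ => by
    ext p q; simp [kroneckerMap_apply, mul_sub]

theorem traceNorm_flaggedChannel_sub (A B : ι → Matrix (Fin d) (Fin d) ℂ)
    (M : Matrix (Fin d) (Fin d) ℂ) :
    traceNorm ((flaggedChannel A - flaggedChannel B) M)
      = ∑ j, traceNorm (A j * M * (A j)ᴴ - B j * M * (B j)ᴴ) := by
  rw [flaggedChannel_sub_apply, traceNorm_sum_single_kronecker]

end Flagged

/-! ### Reduction of the maximum to pure states. -/

section PureStates

variable {α β : Type} [Fintype α] [Fintype β] [DecidableEq β]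

theorem isDensity_vecMulVec {ψ : α → ℂ} (h : star ψ ⬝ᵥ ψ = 1) :
    IsDensity (vecMulVec ψ (star ψ)) :=
  ⟨posSemidef_vecMulVec_self_star ψ, by rw [trace_vecMulVec, dotProduct_comm, h]⟩

/-- Every density operator is a mixture of pure states. -/
theorem IsDensity.exists_eq_sum [DecidableEq α] {ρ : Matrix α α ℂ} (hρ : IsDensity ρ) :
    ∃ (p : α → ℝ) (ψ : α → α → ℂ), (∀ i, 0 ≤ p i) ∧ ∑ i, p i = 1 ∧
      (∀ i, star (ψ i) ⬝ᵥ ψ i = 1) ∧ ρ = ∑ i, (p i : ℂ) • vecMulVec (ψ i) (star (ψ i)) := by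
  obtain ⟨U, l, h1, h2, hU⟩ := hρ.1.1.exists_eq_mul_diagonal_mul
  refine ⟨l, fun i => U.col i, fun i => ?_, ?_, fun i => ?_, ?_⟩
  · have h3 : Uᴴ * ρ * U = diagonal fun i => (l i : ℂ) := by
      calc _ = (Uᴴ * U) * diagonal (fun i => (l i : ℂ)) * (Uᴴ * U) := by
            rw [hU]; simp only [Matrix.mul_assoc]
        _ = _ := by rw [h2, Matrix.one_mul, Matrix.mul_one]
    have h4 := (hρ.1.conjTranspose_mul_mul_same U).diag_nonneg (i := i)
    rw [h3, diagonal_apply_eq] at h4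
    exact Complex.zero_le_real.1 h4
  · have h3 := hρ.2
    rw [hU, trace_mul_comm, ← Matrix.mul_assoc, h2, Matrix.one_mul, trace_diagonal] at h3
    exact_mod_cast h3
  · have := congrFun (congrFun h2 i) i
    simpa [Matrix.mul_apply, dotProduct] using this
  · ext a b
    rw [hU]
    rw [Matrix.mul_apply]
    simp only [mul_diagonal, Matrix.sum_apply, Matrix.smul_apply,
      vecMulVec_apply, col_apply, Pi.star_apply, conjTranspose_apply, smul_eq_mul]
    exact Finset.sum_congr rfl fun i _ => by ring

theorem isCompact_setOf_star_dotProduct_self_eq_one :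
    IsCompact {ψ : α → ℂ | star ψ ⬝ᵥ ψ = 1} := by
  refine Metric.isCompact_of_isClosed_isBounded ?_ ?_
  · exact isClosed_eq (by fun_prop) continuous_const
  · refine (Metric.isBounded_closedBall (x := (0 : α → ℂ)) (r := 1)).subset fun ψ hψ => ?_
    rw [mem_closedBall_zero_iff, pi_norm_le_iff_of_nonneg zero_le_one]
    intro i
    have h1 : ∑ i, ‖ψ i‖ ^ 2 = 1 := by
      have h2 : star ψ ⬝ᵥ ψ = 1 := hψ
      simp only [dotProduct, Pi.star_apply, Complex.star_def, Complex.conj_mul'] at h2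
      exact_mod_cast h2
    have h3 := Finset.single_le_sum (f := fun i => ‖ψ i‖ ^ 2) (fun j _ => sq_nonneg _)
      (Finset.mem_univ i)
    rw [h1] at h3
    exact (sq_le_one_iff₀ (norm_nonneg _)).1 h3

/-- The trace norm of the output of a Hermiticity-preserving map is maximal at a pure state. -/
theorem exists_pure_isGreatest_neNorm [DecidableEq α] [Nonempty α]
    {Φ : Matrix α α ℂ →ₗ[ℂ] Matrix β β ℂ}
    (hΦ : ∀ M : Matrix α α ℂ, M.IsHermitian → (Φ M).IsHermitian) :
    (∃ ψ : α → ℂ, star ψ ⬝ᵥ ψ = 1 ∧ neNorm Φ = traceNorm (Φ (vecMulVec ψ (star ψ)))) ∧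
      ∀ ρ, IsDensity ρ → traceNorm (Φ ρ) ≤ neNorm Φ := by
  have hH : ∀ ψ : α → ℂ, (Φ (vecMulVec ψ (star ψ))).IsHermitian := fun ψ =>
    hΦ _ (posSemidef_vecMulVec_self_star ψ).1
  have hc : Continuous fun ψ : α → ℂ => traceNorm (Φ (vecMulVec ψ (star ψ))) := by
    refine Continuous.traceNorm_of_isHermitian (f := fun ψ => Φ (vecMulVec ψ (star ψ))) ?_ hH
    exact Φ.continuous_of_finiteDimensional.comp (by fun_prop)
  have hne : {ψ : α → ℂ | star ψ ⬝ᵥ ψ = 1}.Nonempty :=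
    ⟨Pi.single (Classical.arbitrary α) 1, by simp⟩
  obtain ⟨ψ, hψ, hmax⟩ := isCompact_setOf_star_dotProduct_self_eq_one.exists_isMaxOn hne
    hc.continuousOn
  -- Convexity: a mixture of pure states does no better than the best pure state.
  have hle : ∀ ρ, IsDensity ρ → traceNorm (Φ ρ) ≤ traceNorm (Φ (vecMulVec ψ (star ψ))) := by
    intro ρ hρ
    obtain ⟨p, φ, hp, hp1, hφ, rfl⟩ := hρ.exists_eq_sum
    rw [map_sum]
    simp only [map_smul]
    refine (traceNorm_sum_smul_le _ (fun i => hH (φ i)) hp).trans ?_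
    calc _ ≤ ∑ i, p i * traceNorm (Φ (vecMulVec ψ (star ψ))) :=
          Finset.sum_le_sum fun i _ => mul_le_mul_of_nonneg_left (hmax (hφ i)) (hp i)
      _ = _ := by rw [← Finset.sum_mul, hp1, one_mul]
  have hg : IsGreatest {r : ℝ | ∃ ρ : Matrix α α ℂ, IsDensity ρ ∧ r = traceNorm (Φ ρ)}
      (traceNorm (Φ (vecMulVec ψ (star ψ)))) := by
    refine ⟨⟨_, isDensity_vecMulVec hψ, rfl⟩, ?_⟩
    rintro r ⟨ρ, hρ, rfl⟩
    exact hle ρ hρ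
  have he : neNorm Φ = traceNorm (Φ (vecMulVec ψ (star ψ))) := hg.csSup_eq
  exact ⟨⟨ψ, hψ, he⟩, fun ρ hρ => he ▸ hle ρ hρ⟩

end PureStates

/-! ### Tight frames of isotropic vectors for traceless matrices. -/

section IsotropicFrame

variable {α : Type} [Fintype α]

theorem re_dotProduct_mulVec_add {H : Matrix α α ℂ} (hH : H.IsHermitian) (x y : α → ℂ) (a b : ℂ) :
    (star (a • x + b • y) ⬝ᵥ H *ᵥ (a • x + b • y)).re
      = ‖a‖ ^ 2 * (star x ⬝ᵥ H *ᵥ x).re + ‖b‖ ^ 2 * (star y ⬝ᵥ H *ᵥ y).re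
        + 2 * (star a * b * (star x ⬝ᵥ H *ᵥ y)).re := by
  have h1 : star y ⬝ᵥ H *ᵥ x = star (star x ⬝ᵥ H *ᵥ y) := by
    rw [← star_dotProduct_star, star_star, star_mulVec, hH.eq, dotProduct_comm,
      ← dotProduct_mulVec, dotProduct_comm]
  have h2 : ∀ z w : ℂ, (star z * z * w).re = ‖z‖ ^ 2 * w.re := fun z w => by
    rw [Complex.star_def, Complex.conj_mul', ← Complex.ofReal_pow, Complex.re_ofReal_mul]
  have h3 : (star b * a * star (star x ⬝ᵥ H *ᵥ y)).re = (star a * b * (star x ⬝ᵥ H *ᵥ y)).re := by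
    rw [← Complex.conj_re (star a * b * (star x ⬝ᵥ H *ᵥ y))]
    simp [mul_comm]
  simp only [mulVec_add, mulVec_smul, star_add, star_smul, add_dotProduct, dotProduct_add,
    smul_dotProduct, dotProduct_smul, smul_eq_mul, h1, mul_add, Complex.add_re, ← mul_assoc]
  rw [mul_comm a (star a), mul_comm b (star b), mul_comm b (star a), mul_comm a (star b), h2, h2,
    h3]
  ring

/-- A unitary mixing of `x` and `y` preserves `xx* + yy*`. A phase `z` makes the cross term `⟨x, H z
y⟩` purely imaginary, so all real rotations of `x` and `z y` stay isotropic for `H`. Along a quarter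
turn the `G`-value changes sign, hence vanishes somewhere. -/
theorem exists_rotation {H G : Matrix α α ℂ} (hH : H.IsHermitian) (hG : G.IsHermitian)
    {x y : α → ℂ} (hx : (star x ⬝ᵥ H *ᵥ x).re = 0) (hy : (star y ⬝ᵥ H *ᵥ y).re = 0)
    (gx : 0 < (star x ⬝ᵥ G *ᵥ x).re) (gy : (star y ⬝ᵥ G *ᵥ y).re < 0) :
    ∃ x' y' : α → ℂ, vecMulVec x' (star x') + vecMulVec y' (star y')
        = vecMulVec x (star x) + vecMulVec y (star y) ∧
      (star x' ⬝ᵥ H *ᵥ x').re = 0 ∧ (star y' ⬝ᵥ H *ᵥ y').re = 0 ∧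
      (star x' ⬝ᵥ G *ᵥ x').re = 0 := by
  obtain ⟨z, hz, hzw⟩ : ∃ z : ℂ, ‖z‖ = 1 ∧ (z * (star x ⬝ᵥ H *ᵥ y)).re = 0 := by
    rcases eq_or_ne (star x ⬝ᵥ H *ᵥ y) 0 with h | h
    · exact ⟨1, by simp, by simp [h]⟩
    · set w := star x ⬝ᵥ H *ᵥ y
      have hn : ‖w‖ ≠ 0 := norm_ne_zero_iff.2 h
      -- This phase gives `z w = i |w|`.
      refine ⟨Complex.I * star w / ‖w‖, by simp [hn], ?_⟩
      have : Complex.I * star w / ‖w‖ * w = Complex.I * (‖w‖ : ℝ) := by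
        have h2 : star w * w = (‖w‖ : ℂ) ^ 2 := Complex.conj_mul' w
        have hn' : (‖w‖ : ℂ) ≠ 0 := by exact_mod_cast hn
        field_simp
        linear_combination h2
      rw [this]; simp
  have hzz : z * star z = 1 := by
    rw [Complex.star_def, Complex.mul_conj', hz]; simp
  obtain ⟨t, -, ht⟩ : ∃ t ∈ Set.Icc 0 (Real.pi / 2),
      (star ((Real.cos t : ℂ) • x + (Real.sin t * z : ℂ) • y) ⬝ᵥ
        G *ᵥ ((Real.cos t : ℂ) • x + (Real.sin t * z : ℂ) • y)).re = 0 := by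
    have hc : Continuous fun t : ℝ =>
        (star ((Real.cos t : ℂ) • x + (Real.sin t * z : ℂ) • y) ⬝ᵥ
          G *ᵥ ((Real.cos t : ℂ) • x + (Real.sin t * z : ℂ) • y)).re := by
      simp only [re_dotProduct_mulVec_add hG, norm_mul, hz, Complex.norm_real]
      fun_prop
    refine intermediate_value_Icc' (by positivity) hc.continuousOn ⟨?_, ?_⟩
    · simp only [re_dotProduct_mulVec_add hG, norm_mul, hz]
      simpa using gy.le
    · simpa using gx.le
  have hcs : (Real.cos t : ℂ) ^ 2 + (Real.sin t : ℂ) ^ 2 = 1 := by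
    exact_mod_cast Real.cos_sq_add_sin_sq t
  refine ⟨(Real.cos t : ℂ) • x + (Real.sin t * z : ℂ) • y,
    (-Real.sin t : ℂ) • x + (Real.cos t * z : ℂ) • y, ?_, ?_, ?_, ht⟩
  · ext i j
    simp only [Matrix.add_apply, vecMulVec_apply, Pi.add_apply, Pi.smul_apply, Pi.star_apply,
      smul_eq_mul, star_add, star_mul', Complex.star_def, Complex.conj_ofReal, map_neg]
    rw [Complex.star_def] at hzz
    linear_combination (x i * (starRingEnd ℂ) (x j)
      + z * (starRingEnd ℂ) z * y i * (starRingEnd ℂ) (y j)) * hcs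
      + y i * (starRingEnd ℂ) (y j) * hzz
  · rw [re_dotProduct_mulVec_add hH, hx, hy, mul_assoc (star _), mul_assoc (_ : ℂ) z]
    simp [hzw, -Complex.ofReal_cos, -Complex.ofReal_sin, Complex.re_ofReal_mul, -Complex.mul_re]
  · rw [re_dotProduct_mulVec_add hH, hx, hy, mul_assoc (star _), mul_assoc (_ : ℂ) z]
    simp [hzw, -Complex.ofReal_cos, -Complex.ofReal_sin, Complex.re_ofReal_mul, -Complex.mul_re]

theorem dotProduct_mulVec_eq_trace (M : Matrix α α ℂ) (x : α → ℂ) :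
    star x ⬝ᵥ M *ᵥ x = (M * vecMulVec x (star x)).trace := by
  rw [mul_vecMulVec, trace_vecMulVec, dotProduct_comm]

/-- A frame of isotropic vectors of a Hermitian form `H` can be replaced by one of vectors that
are isotropic for a second form `G` as well, if `G` vanishes on average. -/
theorem exists_isotropic_frame_of_sum_eq_zero {H G : Matrix α α ℂ} (hH : H.IsHermitian)
    (hG : G.IsHermitian) {ι : Type} [Fintype ι] (n : ℕ) (x : ι → α → ℂ)
    (hx : ∀ i, (star (x i) ⬝ᵥ H *ᵥ x i).re = 0) (hs : ∑ i, (star (x i) ⬝ᵥ G *ᵥ x i).re = 0)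
    (hn : {i | (star (x i) ⬝ᵥ G *ᵥ x i).re ≠ 0}.ncard ≤ n) :
    ∃ y : ι → α → ℂ, ∑ i, vecMulVec (y i) (star (y i)) = ∑ i, vecMulVec (x i) (star (x i)) ∧
      ∀ i, (star (y i) ⬝ᵥ H *ᵥ y i).re = 0 ∧ (star (y i) ⬝ᵥ G *ᵥ y i).re = 0 := by
  classical
  -- Induction on the number of vectors that are not yet isotropic for `G`. As the `G`-values sum to
  -- zero, two of them have opposite signs, and a rotation of that pair makes one vanish.
  induction n generalizing x with
  | zero =>
    refine ⟨x, rfl, fun i => ⟨hx i, ?_⟩⟩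
    have := (Set.ncard_eq_zero (Set.toFinite _)).1 (Nat.le_zero.1 hn)
    by_contra hi
    exact (this ▸ (show i ∈ {i | (star (x i) ⬝ᵥ G *ᵥ x i).re ≠ 0} from hi) : i ∈ (∅ : Set ι))
  | succ n ih =>
    by_cases hz : ∀ i, (star (x i) ⬝ᵥ G *ᵥ x i).re = 0
    · exact ⟨x, rfl, fun i => ⟨hx i, hz i⟩⟩
    push Not at hz
    obtain ⟨k, hk⟩ := hz
    obtain ⟨i, -, hi⟩ := Finset.exists_pos_of_sum_zero_of_exists_nonzero _ hs
      ⟨k, Finset.mem_univ _, hk⟩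
    obtain ⟨j, -, hj⟩ := Finset.exists_pos_of_sum_zero_of_exists_nonzero
      (fun i => -(star (x i) ⬝ᵥ G *ᵥ x i).re) (by simp [hs])
      ⟨k, Finset.mem_univ _, neg_ne_zero.2 hk⟩
    rw [neg_pos] at hj
    have hij : i ≠ j := by rintro rfl; exact lt_asymm hi hj
    obtain ⟨x', y', h1, h2, h3, h4⟩ := exists_rotation hH hG (hx i) (hx j) hi hj
    set w : ι → α → ℂ := Function.update (Function.update x i x') j y' with hw
    have wj : w j = y' := by simp [hw]
    have wi : w i = x' := by simp [hw, hij]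
    have wk : ∀ k, k ≠ i → k ≠ j → w k = x k := fun k hi hj => by simp [hw, hi, hj]
    have hsum : ∑ i, vecMulVec (w i) (star (w i)) = ∑ i, vecMulVec (x i) (star (x i)) := by
      have hmem : j ∈ Finset.univ.erase i := by simp [hij.symm]
      rw [← Finset.add_sum_erase _ _ (Finset.mem_univ i), ← Finset.add_sum_erase _ _ hmem,
        ← Finset.add_sum_erase _ _ (Finset.mem_univ i), ← Finset.add_sum_erase _ _ hmem,
        ← add_assoc, ← add_assoc, wi, wj, h1]
      congr 1
      refine Finset.sum_congr rfl fun k hk => ?_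
      simp only [Finset.mem_erase] at hk
      rw [wk k hk.2.1 hk.1]
    have hwH : ∀ k, (star (w k) ⬝ᵥ H *ᵥ w k).re = 0 := by
      intro k
      by_cases hki : k = i
      · rw [hki, wi, h2]
      by_cases hkj : k = j
      · rw [hkj, wj, h3]
      rw [wk k hki hkj, hx]
    -- The total of the `G`-values depends only on `∑ xᵢ xᵢ*`, which the rotation preserves.
    have hwG : ∑ k, (star (w k) ⬝ᵥ G *ᵥ w k).re = 0 := by
      rw [← hs]
      simp only [dotProduct_mulVec_eq_trace, ← Complex.re_sum, ← trace_sum, ← Matrix.mul_sum, hsum]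
    obtain ⟨y, hy1, hy2⟩ := ih w hwH hwG (by
      -- Index `i` leaves the set of non-isotropic vectors, and `j` was already in it, so the set
      -- shrinks strictly whatever happens at `j`.
      rw [← Nat.lt_succ_iff]
      refine (Set.ncard_lt_ncard ⟨fun k hk => ?_, fun h => ?_⟩ (Set.toFinite _)).trans_le hn
      · have hki : k ≠ i := by rintro rfl; exact hk (by rw [wi, h4])
        by_cases hkj : k = j
        · exact hkj ▸ hj.ne
        · simpa [wk k hki hkj] using hk
      · exact h (show i ∈ _ from hi.ne') (by rw [wi, h4]))
    exact ⟨y, hy1.trans hsum, hy2⟩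

/-- A traceless matrix has a tight frame of isotropic vectors. -/
theorem exists_isotropic_frame [DecidableEq α] {M : Matrix α α ℂ} (hM : M.trace = 0) :
    ∃ x : α → α → ℂ, ∑ i, vecMulVec (x i) (star (x i)) = 1 ∧
      ∀ i, star (x i) ⬝ᵥ M *ᵥ x i = 0 := by
  have hstar : ∀ x : α → ℂ, star x ⬝ᵥ Mᴴ *ᵥ x = star (star x ⬝ᵥ M *ᵥ x) := fun x => by
    rw [← star_dotProduct_star, star_star, star_mulVec, dotProduct_comm, ← dotProduct_mulVec,
      dotProduct_comm]
  -- The forms of `M + M*` and `i (M* - M)` are twice the real and the imaginary part of the form of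
  -- `M`.
  have hH : (M + Mᴴ).IsHermitian := by
    rw [IsHermitian, conjTranspose_add, conjTranspose_conjTranspose, add_comm]
  have hG : (Complex.I • (Mᴴ - M)).IsHermitian := by
    rw [IsHermitian, conjTranspose_smul, conjTranspose_sub, conjTranspose_conjTranspose]
    simp only [Complex.star_def, Complex.conj_I]
    module
  have hb : ∑ i, vecMulVec (Pi.single i 1 : α → ℂ) (star (Pi.single i 1)) = 1 := by
    ext a b
    simp [Matrix.sum_apply, vecMulVec_apply, Pi.single_apply, one_apply]
  have hav : ∀ {N : Matrix α α ℂ}, N.trace = 0 → ∀ {x : α → α → ℂ},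
      ∑ i, vecMulVec (x i) (star (x i)) = 1 → ∑ i, (star (x i) ⬝ᵥ N *ᵥ x i).re = 0 := by
    intro N hN x hx
    simp only [dotProduct_mulVec_eq_trace, ← Complex.re_sum, ← trace_sum, ← Matrix.mul_sum, hx,
      Matrix.mul_one, hN, Complex.zero_re]
  have hM' : (Mᴴ).trace = 0 := by rw [trace_conjTranspose, hM, star_zero]
  -- From the standard basis, a first pass with the zero form as `H` kills the real part; a second
  -- pass kills the imaginary part while keeping the real part zero.
  obtain ⟨y, hy, hy0⟩ := exists_isotropic_frame_of_sum_eq_zero isHermitian_zero hH _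
    (fun i : α => (Pi.single i 1 : α → ℂ)) (by simp)
    (hav (by rw [trace_add, hM, hM', add_zero]) hb) le_rfl
  rw [hb] at hy
  obtain ⟨x, hx, hx0⟩ := exists_isotropic_frame_of_sum_eq_zero hH hG _ y (fun i => (hy0 i).2)
    (hav (by rw [trace_smul, trace_sub, hM, hM', sub_zero, smul_zero]) hy) le_rfl
  refine ⟨x, hx.trans hy, fun i => ?_⟩
  obtain ⟨h1, h2⟩ := hx0 i
  rw [add_mulVec, dotProduct_add, hstar] at h1
  rw [smul_mulVec, dotProduct_smul, sub_mulVec, dotProduct_sub, hstar] at h2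
  apply Complex.ext
  · simp at h1 ⊢; linarith
  · simp at h2 ⊢; linarith

end IsotropicFrame

/-! ### Finite-round LOCC measurements. -/

section LOCC

/-- A local round pulls measurements back along complete Kraus families, which preserves positivity
and the sum `1`. This makes the bound 2 available for LOCC. -/
theorem IsFiniteLOCC.posSemidef {α β : Type} [Fintype α] [DecidableEq α] [Fintype β]
    [DecidableEq β] {P Q : Matrix (α × β) (α × β) ℂ} (h : IsFiniteLOCC P Q) :
    P.PosSemidef ∧ Q.PosSemidef ∧ P + Q = 1 := by
  induction h with
  | guessZero => exact ⟨.one, .zero, add_zero _⟩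
  | guessOne => exact ⟨.zero, .one, zero_add _⟩
  | first K hK P Q h ih =>
    refine ⟨posSemidef_sum _ fun i _ => (ih i).1.conjTranspose_mul_mul_same _,
      posSemidef_sum _ fun i _ => (ih i).2.1.conjTranspose_mul_mul_same _, ?_⟩
    simp only [← Finset.sum_add_distrib, ← Matrix.add_mul, ← Matrix.mul_add, (ih _).2.2,
      Matrix.mul_one]
    exact sum_kronecker_one hK
  | second K hK P Q h ih =>
    refine ⟨posSemidef_sum _ fun i _ => (ih i).1.conjTranspose_mul_mul_same _,
      posSemidef_sum _ fun i _ => (ih i).2.1.conjTranspose_mul_mul_same _, ?_⟩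
    simp only [← Finset.sum_add_distrib, ← Matrix.add_mul, ← Matrix.mul_add, (ih _).2.2,
      Matrix.mul_one]
    exact sum_one_kronecker hK

variable {α β : Type} [Fintype α] [DecidableEq α] [Fintype β] [DecidableEq β]

theorem isFiniteLOCC_one_kronecker {E : Matrix β β ℂ} (hE : E.IsHermitian) (hE2 : E * E = E) :
    IsFiniteLOCC ((1 : Matrix α α ℂ) ⊗ₖ E) ((1 : Matrix α α ℂ) ⊗ₖ (1 - E)) := by
  have hF : (1 - E)ᴴ = 1 - E := by rw [conjTranspose_sub, conjTranspose_one, hE.eq]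
  have hF2 : (1 - E) * (1 - E) = 1 - E := by
    rw [Matrix.sub_mul, Matrix.mul_sub, Matrix.mul_sub, hE2]; simp
  have h := IsFiniteLOCC.second (α := α) ![E, 1 - E]
    (by simp [Fin.sum_univ_two, hE.eq, hE2, hF, hF2])
    ![1, 0] ![0, 1] (fun i => by
      fin_cases i
      · exact IsFiniteLOCC.guessZero
      · exact IsFiniteLOCC.guessOne)
  simpa [Fin.sum_univ_two, conjTranspose_kronecker, ← mul_kronecker_mul, hE.eq, hE2, hF, hF2]
    using h

/-- One-way protocols: the first party measures a tight frame, the second one a projection that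
depends on the outcome. -/
theorem isFiniteLOCC_sum_vecMulVec_kronecker {ι : Type} [Fintype ι] {a : ι → α → ℂ}
    (ha : ∑ i, vecMulVec (a i) (star (a i)) = 1) {E : ι → Matrix β β ℂ}
    (hE : ∀ i, (E i).IsHermitian) (hE2 : ∀ i, E i * E i = E i) :
    IsFiniteLOCC (∑ i, vecMulVec (a i) (star (a i)) ⊗ₖ E i)
      (∑ i, vecMulVec (a i) (star (a i)) ⊗ₖ (1 - E i)) := by
  -- The first party's Kraus operators are the rows `⟨aᵢ|`, so its system becomes one-dimensional,
  -- with index type `Unit`.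
  have hK : ∀ i, (replicateRow Unit (star (a i)))ᴴ * replicateRow Unit (star (a i))
      = vecMulVec (a i) (star (a i)) := fun i => by
    ext b c; simp [Matrix.mul_apply, vecMulVec_apply]
  have hKE : ∀ i (F : Matrix β β ℂ),
      (replicateRow Unit (star (a i)) ⊗ₖ (1 : Matrix β β ℂ))ᴴ * ((1 : Matrix Unit Unit ℂ) ⊗ₖ F)
        * (replicateRow Unit (star (a i)) ⊗ₖ (1 : Matrix β β ℂ))
      = vecMulVec (a i) (star (a i)) ⊗ₖ F := fun i F => by
    rw [conjTranspose_kronecker, ← mul_kronecker_mul, ← mul_kronecker_mul, Matrix.mul_one, hK,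
      conjTranspose_one, Matrix.one_mul, Matrix.mul_one]
  set e := (Fintype.equivFin ι).symm
  have h := IsFiniteLOCC.first (β := β) (fun i => replicateRow Unit (star (a (e i))))
    (by simp only [hK]; rw [← ha]; exact Equiv.sum_comp e fun i => vecMulVec (a i) (star (a i)))
    _ _ (fun i => isFiniteLOCC_one_kronecker (α := Unit) (hE (e i)) (hE2 (e i)))
  simp only [hKE] at h
  rwa [Equiv.sum_comp e fun i => vecMulVec (a i) (star (a i)) ⊗ₖ E i,
    Equiv.sum_comp e fun i => vecMulVec (a i) (star (a i)) ⊗ₖ (1 - E i)] at h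

end LOCC

/-! ### Error-free outcomes and separating projections. -/

section Discrimination

variable {α β : Type} [Fintype α] [Fintype β]

theorem hsInner_sum_vecMulVec_eq_zero {ι : Type} [Fintype ι] {P : Matrix α α ℂ}
    (hP : P.IsHermitian) {ψ : ι → α → ℂ} (h : ∀ j, P *ᵥ ψ j = 0) :
    hsInner P (∑ j, vecMulVec (ψ j) (star (ψ j))) = 0 := by
  rw [hsInner, hP.eq, Matrix.mul_sum, Finset.sum_eq_zero, trace_zero]
  intro j _
  rw [mul_vecMulVec, h, zero_vecMulVec]

/-- The product acts on `ψ` as `a ⊗ F φ`, where `φ` is the contraction of `ψ` with `b` in the first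
factor. -/
theorem vecMulVec_kronecker_mulVec_eq_zero {a b : α → ℂ} {F : Matrix β β ℂ} {ψ : α × β → ℂ}
    (h : F *ᵥ (fun z => ∑ i, b i * ψ (i, z)) = 0) : (vecMulVec a b ⊗ₖ F) *ᵥ ψ = 0 := by
  ext ⟨i, y⟩
  have h1 := congrFun h y
  simp only [mulVec, dotProduct, Pi.zero_apply, Finset.mul_sum] at h1
  simp only [mulVec, dotProduct, kroneckerMap_apply, vecMulVec_apply, Pi.zero_apply,
    Fintype.sum_prod_type_right]
  calc _ = a i * ∑ z, ∑ j, F y z * (b j * ψ (j, z)) := by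
        rw [Finset.mul_sum]
        refine Finset.sum_congr rfl fun z _ => ?_
        rw [Finset.mul_sum]
        exact Finset.sum_congr rfl fun j _ => by ring
    _ = 0 := by rw [h1, mul_zero]

/-- Two orthogonal vectors are separated by a projection. -/
theorem exists_projection [DecidableEq β] {v w : β → ℂ} (h : star v ⬝ᵥ w = 0) :
    ∃ E : Matrix β β ℂ, E.IsHermitian ∧ E * E = E ∧ (1 - E) *ᵥ v = 0 ∧ E *ᵥ w = 0 := by
  -- For `v = 0` there is nothing to normalize, and the zero projection works.
  rcases eq_or_ne v 0 with rfl | hv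
  · exact ⟨0, isHermitian_zero, by simp, by simp, by simp⟩
  have hn : star v ⬝ᵥ v ≠ 0 := by simpa using hv
  have hs : star (star v ⬝ᵥ v) = star v ⬝ᵥ v := by rw [← star_dotProduct_star, star_star]
  refine ⟨(star v ⬝ᵥ v)⁻¹ • vecMulVec v (star v), ?_, ?_, ?_, ?_⟩
  · rw [IsHermitian, conjTranspose_smul, conjTranspose_vecMulVec, star_star, star_inv₀, hs]
  · rw [Matrix.smul_mul, Matrix.mul_smul, vecMulVec_mul_vecMulVec, vecMulVec_smul, smul_smul,
      smul_smul, mul_assoc, inv_mul_cancel₀ hn, mul_one]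
  · rw [sub_mulVec, one_mulVec, smul_mulVec, vecMulVec_mulVec]
    simp [smul_smul, inv_mul_cancel₀ hn]
  · rw [smul_mulVec, vecMulVec_mulVec, h]
    simp

theorem hsInner_eq_one [DecidableEq α] {P Q ρ : Matrix α α ℂ} (hP : P.IsHermitian)
    (hQ : Q.IsHermitian) (hPQ : P + Q = 1) (hρ : ρ.trace = 1) (h : hsInner Q ρ = 0) :
    hsInner P ρ = 1 := by
  rw [hsInner, hQ.eq] at h
  have h1 : ((P + Q) * ρ).trace = 1 := by rw [hPQ, Matrix.one_mul, hρ]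
  rwa [Matrix.add_mul, trace_add, h, add_zero, ← hP.eq] at h1

end Discrimination

/-! ### The discrimination protocol and the norms of flagged differences. -/

section FlaggedDiscrimination

variable {d : ℕ} {ι κ : Type} [DecidableEq ι] [DecidableEq κ]

/-- The maximally entangled vector, with respect to an embedding of the index sets. -/
noncomputable def maxEntangled (e : Fin d ↪ κ) : Fin d × κ → ℂ :=
  fun p => if e p.1 = p.2 then ((√d)⁻¹ : ℝ) else 0

theorem star_maxEntangled_dotProduct [Fintype κ] [NeZero d] (e : Fin d ↪ κ) :
    star (maxEntangled e) ⬝ᵥ maxEntangled e = 1 := by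
  have hd : (d : ℝ) ≠ 0 := by exact_mod_cast NeZero.ne d
  have h : (((√d)⁻¹ : ℝ) : ℂ) * (((√d)⁻¹ : ℝ) : ℂ) = (d : ℂ)⁻¹ := by
    rw [← Complex.ofReal_mul, ← mul_inv, Real.mul_self_sqrt (Nat.cast_nonneg d)]
    simp
  simp only [maxEntangled, dotProduct, Pi.star_apply, Fintype.sum_prod_type, apply_ite star,
    star_zero, Complex.star_def, Complex.conj_ofReal, ite_mul, mul_ite, mul_zero, zero_mul, h]
  simp [NeZero.ne d]

variable [Fintype κ]

theorem flaggedKraus_kronecker_mulVec_maxEntangled (A : ι → Matrix (Fin d) (Fin d) ℂ)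
    (e : Fin d ↪ κ) (j : ι) (i : ι) (a : Fin d) (z : κ) :
    ((flaggedKraus A j ⊗ₖ (1 : Matrix κ κ ℂ)) *ᵥ maxEntangled e) ((i, a), z)
      = if i = j then ∑ b, A j a b * maxEntangled e (b, z) else 0 := by
  simp only [mulVec, dotProduct, kroneckerMap_apply, flaggedKraus, of_apply, one_apply,
    Fintype.sum_prod_type, ite_mul, mul_ite, zero_mul, mul_zero, mul_one]
  split_ifs <;> simp

/-- Contracting with `x` leaves the ancilla in the row vector `x* A`, embedded along `e` and scaled
by `1 / √d`; since `e` is injective, inner products survive up to `1 / d`. Orthogonality of the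
conditional vectors is thus isotropy of `x` for `B A*`. -/
theorem star_dotProduct_conditional (A B : Matrix (Fin d) (Fin d) ℂ) (e : Fin d ↪ κ)
    (x : Fin d → ℂ) :
    star (fun z => ∑ a, star (x a) * ∑ b, A a b * maxEntangled e (b, z)) ⬝ᵥ
        (fun z => ∑ a, star (x a) * ∑ b, B a b * maxEntangled e (b, z))
      = (d : ℂ)⁻¹ * (star x ⬝ᵥ (B * Aᴴ) *ᵥ x) := by
  have h : (((√d)⁻¹ : ℝ) : ℂ) * (((√d)⁻¹ : ℝ) : ℂ) = (d : ℂ)⁻¹ := by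
    rw [← Complex.ofReal_mul, ← mul_inv, Real.mul_self_sqrt (Nat.cast_nonneg d)]
    simp
  have hw : ∀ C : Matrix (Fin d) (Fin d) ℂ, ∀ z,
      ∑ a, star (x a) * ∑ b, C a b * maxEntangled e (b, z)
        = ∑ b, (star x ᵥ* C) b * maxEntangled e (b, z) := by
    intro C z
    simp only [vecMul, dotProduct, Finset.sum_mul, Finset.mul_sum, Pi.star_apply]
    rw [Finset.sum_comm]
    simp only [mul_assoc]
  simp only [hw]
  have hsum : ∀ u v : Fin d → ℂ,
      star (fun z => ∑ b, u b * maxEntangled e (b, z)) ⬝ᵥ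
        (fun z => ∑ b, v b * maxEntangled e (b, z)) = (d : ℂ)⁻¹ * (star u ⬝ᵥ v) := by
    intro u v
    simp only [dotProduct, Pi.star_apply, star_sum, star_mul', Finset.sum_mul_sum]
    rw [Finset.sum_comm, Finset.mul_sum]
    refine Finset.sum_congr rfl fun b _ => ?_
    rw [Finset.sum_comm]
    simp only [maxEntangled, apply_ite star, star_zero, Complex.star_def, Complex.conj_ofReal,
      mul_ite, ite_mul, mul_zero, zero_mul, Finset.sum_ite_eq, Finset.mem_univ, if_true]
    simp only [EmbeddingLike.apply_eq_iff_eq, Finset.sum_ite_eq,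
      Finset.mem_univ, if_true]
    rw [← h]; ring
  rw [hsum, star_vecMul, star_star, ← mulVec_mulVec, dotProduct_comm, ← dotProduct_mulVec]

variable [Fintype ι]

theorem ampliation_flaggedChannel_vecMulVec (A : ι → Matrix (Fin d) (Fin d) ℂ)
    (φ : Fin d × κ → ℂ) :
    ampliation (flaggedChannel A) κ (vecMulVec φ (star φ))
      = ∑ j, vecMulVec ((flaggedKraus A j ⊗ₖ (1 : Matrix κ κ ℂ)) *ᵥ φ)
          (star ((flaggedKraus A j ⊗ₖ (1 : Matrix κ κ ℂ)) *ᵥ φ)) := by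
  rw [ampliation_eq_sum (flaggedChannel_eq_sum A)]
  refine Finset.sum_congr rfl fun j _ => ?_
  rw [mul_vecMulVec, vecMulVec_mul, star_mulVec]

/-- Flagged channels whose Kraus operators are orthogonal are discriminated without error by a
maximally entangled state and a one-way protocol. -/
theorem exists_perfect_discrimination [NeZero d] {A₀ A₁ : ι → Matrix (Fin d) (Fin d) ℂ}
    (h₀ : ∑ j, (A₀ j)ᴴ * A₀ j = 1) (h₁ : ∑ j, (A₁ j)ᴴ * A₁ j = 1)
    (horth : ∀ j, hsInner (A₀ j) (A₁ j) = 0) (hκ : d ≤ Fintype.card κ) :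
    ∃ ρ : Matrix (Fin d × κ) (Fin d × κ) ℂ, IsDensity ρ ∧
      ∃ P₀ P₁ : Matrix ((ι × Fin d) × κ) ((ι × Fin d) × κ) ℂ, IsFiniteLOCC P₀ P₁ ∧
        hsInner P₀ (ampliation (flaggedChannel A₀) κ ρ) = 1 ∧
        hsInner P₁ (ampliation (flaggedChannel A₁) κ ρ) = 1 := by
  obtain ⟨e⟩ : Nonempty (Fin d ↪ κ) := Function.Embedding.nonempty_of_card_le (by simpa using hκ)
  have htr : ∀ j, (A₁ j * (A₀ j)ᴴ).trace = 0 := fun j => by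
    rw [trace_mul_comm]; exact horth j
  choose x hx hx0 using fun j => exists_isotropic_frame (htr j)
  have hE : ∀ p : ι × Fin d, _ := fun p => exists_projection (β := κ)
    ((star_dotProduct_conditional (A₀ p.1) (A₁ p.1) e (x p.1 p.2)).trans
      (by rw [hx0, mul_zero]))
  choose E hE1 hE2 hE3 hE4 using hE
  -- `a p` is `|p.1⟩ ⊗ x`: this frame reads the flag and measures the isotropic frame belonging to
  -- it in a single local step.
  let a : ι × Fin d → ι × Fin d → ℂ := fun p q => if q.1 = p.1 then x p.1 p.2 q.2 else 0
  have ha : ∑ p, vecMulVec (a p) (star (a p)) = 1 := by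
    ext ⟨i, b⟩ ⟨j, c⟩
    have h1 := fun k => congrFun (congrFun (hx k) b) c
    simp only [Matrix.sum_apply, vecMulVec_apply, Pi.star_apply] at h1
    simp only [Matrix.sum_apply, vecMulVec_apply, Pi.star_apply, a, Fintype.sum_prod_type,
      apply_ite star, star_zero, mul_ite, ite_mul, zero_mul, mul_zero]
    rw [Finset.sum_eq_single j (fun k _ hk => by simp [hk.symm]) (by simp)]
    by_cases hij : i = j
    · simpa [hij, one_apply] using h1 j
    · simp [hij, one_apply]
  have hL := isFiniteLOCC_sum_vecMulVec_kronecker ha hE1 hE2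
  obtain ⟨hP, hQ, hPQ⟩ := hL.posSemidef
  have hφ := isDensity_vecMulVec (star_maxEntangled_dotProduct (d := d) e)
  -- On the branch with flag `j`, outcomes carrying another flag have amplitude zero; for the others
  -- `F p` kills the conditional ancilla vector. It is used with `1 - E` for `A₀` and with `E` for
  -- `A₁`.
  have hcond : ∀ (A : ι → Matrix (Fin d) (Fin d) ℂ) (F : ι × Fin d → Matrix κ κ ℂ),
      (∀ p, F p *ᵥ (fun z => ∑ c, star (x p.1 p.2 c) *
        ∑ b, A p.1 c b * maxEntangled e (b, z)) = 0) →
      ∀ j, (∑ p, vecMulVec (a p) (star (a p)) ⊗ₖ F p) *ᵥ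
        ((flaggedKraus A j ⊗ₖ (1 : Matrix κ κ ℂ)) *ᵥ maxEntangled e) = 0 := by
    intro A F hF j
    rw [sum_mulVec]
    refine Finset.sum_eq_zero fun p _ => vecMulVec_kronecker_mulVec_eq_zero ?_
    simp only [Fintype.sum_prod_type, flaggedKraus_kronecker_mulVec_maxEntangled, a,
      Pi.star_apply, apply_ite star, star_zero, mul_ite, ite_mul, zero_mul, mul_zero]
    by_cases hj : j = p.1
    · subst hj
      refine Eq.trans ?_ (hF p)
      congr 1
      funext z
      rw [Finset.sum_eq_single p.1 (fun k _ hk => by simp [hk]) (by simp)]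
      simp
    · have : (fun z => ∑ i, ∑ c, if i = p.1 then if i = j then
          star (x p.1 p.2 c) * ∑ b, A j c b * maxEntangled e (b, z) else 0 else 0)
          = (0 : κ → ℂ) := by
        funext z
        refine Finset.sum_eq_zero fun i _ => Finset.sum_eq_zero fun c _ => ?_
        split_ifs with h1 h2
        · exact absurd (h2.symm.trans h1) hj
        all_goals rfl
      rw [this, mulVec_zero]
  refine ⟨_, hφ, _, _, hL, ?_, ?_⟩
  · refine hsInner_eq_one hP.1 hQ.1 hPQ (isDensity_ampliation_flaggedChannel h₀ hφ).2 ?_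
    rw [ampliation_flaggedChannel_vecMulVec]
    exact hsInner_sum_vecMulVec_eq_zero hQ.1 (hcond A₀ _ hE3)
  · refine hsInner_eq_one hQ.1 hP.1 (by rw [add_comm, hPQ])
      (isDensity_ampliation_flaggedChannel h₁ hφ).2 ?_
    rw [ampliation_flaggedChannel_vecMulVec]
    exact hsInner_sum_vecMulVec_eq_zero hP.1 (hcond A₁ _ hE4)

theorem ampliation_sub {α β : Type} (Φ Ψ : Matrix α α ℂ →ₗ[ℂ] Matrix β β ℂ) (κ : Type)
    (M : Matrix (α × κ) (α × κ) ℂ) :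
    ampliation (Φ - Ψ) κ M = ampliation Φ κ M - ampliation Ψ κ M := rfl

/-- `(P - Q)(ρ - σ) + (P + Q)(ρ + σ) = 2 P ρ + 2 Q σ`, so the trace is `2 + 2 - 2`. -/
theorem re_hsInner_sub_eq_two {α : Type} [Fintype α] [DecidableEq α] {P Q ρ σ : Matrix α α ℂ}
    (hP : P.IsHermitian) (hQ : Q.IsHermitian) (hPQ : P + Q = 1) (hρ : ρ.trace = 1)
    (hσ : σ.trace = 1) (h₀ : hsInner P ρ = 1) (h₁ : hsInner Q σ = 1) :
    (hsInner (P - Q) (ρ - σ)).re = 2 := by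
  have h2 : ((P + Q) * (ρ + σ)).trace = 2 := by
    rw [hPQ, Matrix.one_mul, trace_add, hρ, hσ]; norm_num
  rw [hsInner, hP.eq] at h₀
  rw [hsInner, hQ.eq] at h₁
  rw [hsInner, (hP.sub hQ).eq]
  have h3 : ((P - Q) * (ρ - σ)).trace = 2 := by
    simp only [Matrix.add_mul, Matrix.mul_add, Matrix.sub_mul, Matrix.mul_sub, trace_add,
      trace_sub] at h2 ⊢
    linear_combination 2 * h₀ + 2 * h₁ - h2
  rw [h3]; rfl

theorem loccNorm_flaggedChannel_sub [NeZero d] {A₀ A₁ : ι → Matrix (Fin d) (Fin d) ℂ}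
    (h₀ : ∑ j, (A₀ j)ᴴ * A₀ j = 1) (h₁ : ∑ j, (A₁ j)ᴴ * A₁ j = 1)
    (horth : ∀ j, hsInner (A₀ j) (A₁ j) = 0) (hκ : d ≤ Fintype.card κ) :
    loccNorm κ (flaggedChannel A₀ - flaggedChannel A₁) = 2 := by
  refine IsGreatest.csSup_eq ⟨?_, ?_⟩
  · obtain ⟨ρ, hρ, P, Q, hL, hP1, hQ1⟩ := exists_perfect_discrimination h₀ h₁ horth hκ
    obtain ⟨hP, hQ, hPQ⟩ := hL.posSemidef
    refine ⟨(P, Q), subset_closure hL, ρ, hρ, ?_⟩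
    rw [ampliation_sub]
    exact (re_hsInner_sub_eq_two hP.1 hQ.1 hPQ (isDensity_ampliation_flaggedChannel h₀ hρ).2
      (isDensity_ampliation_flaggedChannel h₁ hρ).2 hP1 hQ1).symm
  · rintro r ⟨P, hP, ρ, hρ, rfl⟩
    rw [ampliation_sub]
    set σ₀ := ampliation (flaggedChannel A₀) κ ρ with hσ₀
    set σ₁ := ampliation (flaggedChannel A₁) κ ρ with hσ₁
    -- The bound by 2 is a closed condition, so it passes from finite-round protocols to their
    -- closure.
    have hc : IsClosed {P : Matrix ((ι × Fin d) × κ) ((ι × Fin d) × κ) ℂ ×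
        Matrix ((ι × Fin d) × κ) ((ι × Fin d) × κ) ℂ |
        (hsInner (P.1 - P.2) (σ₀ - σ₁)).re ≤ 2} := by
      refine isClosed_le ?_ continuous_const
      simp only [hsInner]
      fun_prop
    refine closure_minimal ?_ hc hP
    intro P (hP : IsFiniteLOCC P.1 P.2)
    obtain ⟨h1, h2, h3⟩ := hP.posSemidef
    change (hsInner (P.1 - P.2) (σ₀ - σ₁)).re ≤ 2
    rw [hsInner, (h1.1.sub h2.1).eq]
    exact re_trace_le_two h1 h2 h3 (isDensity_ampliation_flaggedChannel h₀ hρ)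
      (isDensity_ampliation_flaggedChannel h₁ hρ)

theorem diamondNorm_flaggedChannel_sub [NeZero d] {A₀ A₁ : ι → Matrix (Fin d) (Fin d) ℂ}
    (h₀ : ∑ j, (A₀ j)ᴴ * A₀ j = 1) (h₁ : ∑ j, (A₁ j)ᴴ * A₁ j = 1)
    (horth : ∀ j, hsInner (A₀ j) (A₁ j) = 0) :
    diamondNorm (flaggedChannel A₀ - flaggedChannel A₁) = 2 := by
  refine IsGreatest.csSup_eq ⟨?_, ?_⟩
  · obtain ⟨ρ, hρ, P, Q, hL, hP1, hQ1⟩ :=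
      exists_perfect_discrimination (κ := Fin d) h₀ h₁ horth (by simp)
    obtain ⟨hP, hQ, hPQ⟩ := hL.posSemidef
    have hσ₀ := isDensity_ampliation_flaggedChannel h₀ hρ
    have hσ₁ := isDensity_ampliation_flaggedChannel h₁ hρ
    refine ⟨ρ, hρ, ?_⟩
    rw [ampliation_sub]
    -- The LOCC protocol is in particular a measurement, so by duality its value 2 is a lower bound
    -- for the trace norm.
    refine le_antisymm ?_ (traceNorm_sub_le_two hσ₀ hσ₁)
    rw [← re_hsInner_sub_eq_two hP.1 hQ.1 hPQ hσ₀.2 hσ₁.2 hP1 hQ1, hsInner,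
      (hP.1.sub hQ.1).eq]
    exact re_trace_mul_le_traceNorm (hσ₀.1.1.sub hσ₁.1.1) hP hQ hPQ
  · rintro r ⟨ρ, hρ, rfl⟩
    rw [ampliation_sub]
    exact traceNorm_sub_le_two (isDensity_ampliation_flaggedChannel h₀ hρ)
      (isDensity_ampliation_flaggedChannel h₁ hρ)

theorem isHermitian_flaggedChannel_sub (A₀ A₁ : ι → Matrix (Fin d) (Fin d) ℂ)
    (M : Matrix (Fin d) (Fin d) ℂ) (hM : M.IsHermitian) :
    ((flaggedChannel A₀ - flaggedChannel A₁) M).IsHermitian :=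
  (isHermitian_flaggedChannel A₀ hM).sub (isHermitian_flaggedChannel A₁ hM)

theorem isGreatest_neNorm_flaggedChannel_sub [NeZero d] (A₀ A₁ : ι → Matrix (Fin d) (Fin d) ℂ) :
    IsGreatest {r : ℝ | ∃ ρ : Matrix (Fin d) (Fin d) ℂ, IsDensity ρ ∧
        r = ∑ j, traceNorm (A₀ j * ρ * (A₀ j)ᴴ - A₁ j * ρ * (A₁ j)ᴴ)}
      (neNorm (flaggedChannel A₀ - flaggedChannel A₁)) := by
  obtain ⟨⟨ψ, hψ, he⟩, hle⟩ :=
    exists_pure_isGreatest_neNorm (isHermitian_flaggedChannel_sub A₀ A₁)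
  refine ⟨⟨_, isDensity_vecMulVec hψ, ?_⟩, ?_⟩
  · rw [he, traceNorm_flaggedChannel_sub]
  · rintro r ⟨ρ, hρ, rfl⟩
    rw [← traceNorm_flaggedChannel_sub]
    exact hle ρ hρ

end FlaggedDiscrimination

/-! ### Orthogonal traceless unitaries: Parseval and the pure-state formula. -/

section UnitaryFamily

variable {d : ℕ} {ι : Type}

theorem scaledKraus_mul_mul_conjTranspose (hd : 2 ≤ d) (W : ι → Matrix (Fin d) (Fin d) ℂ) (j : ι)
    (M : Matrix (Fin d) (Fin d) ℂ) :
    scaledKraus W j * M * (scaledKraus W j)ᴴ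
      = ((((d : ℝ) ^ 2 - 1)⁻¹ : ℝ) : ℂ) • (W j * M * (W j)ᴴ) := by
  have h2 : (2 : ℝ) ≤ d := by exact_mod_cast hd
  rw [scaledKraus, conjTranspose_smul, star_trivial, Matrix.smul_mul, Matrix.smul_mul,
    Matrix.mul_smul, smul_smul, ← mul_inv, Real.mul_self_sqrt (by nlinarith), Complex.coe_smul]

theorem conjTranspose_scaledKraus_mul (hd : 2 ≤ d) (V W : ι → Matrix (Fin d) (Fin d) ℂ) (j : ι) :
    (scaledKraus V j)ᴴ * scaledKraus W j
      = ((((d : ℝ) ^ 2 - 1)⁻¹ : ℝ) : ℂ) • ((V j)ᴴ * W j) := by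
  have h2 : (2 : ℝ) ≤ d := by exact_mod_cast hd
  rw [scaledKraus, scaledKraus, conjTranspose_smul, star_trivial, Matrix.smul_mul,
    Matrix.mul_smul, smul_smul, ← mul_inv, Real.mul_self_sqrt (by nlinarith), Complex.coe_smul]

variable [Fintype ι]

theorem sum_conjTranspose_scaledKraus_mul (hd : 2 ≤ d) (hι : Fintype.card ι + 1 = d ^ 2)
    {W : ι → Matrix (Fin d) (Fin d) ℂ} (hW : ∀ j, W j ∈ Matrix.unitaryGroup (Fin d) ℂ) :
    ∑ j, (scaledKraus W j)ᴴ * scaledKraus W j = 1 := by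
  have h2 : (2 : ℝ) ≤ d := by exact_mod_cast hd
  have hc : (Fintype.card ι : ℝ) = (d : ℝ) ^ 2 - 1 := by
    rw [eq_sub_iff_add_eq]; exact_mod_cast hι
  have h : ∀ j, (scaledKraus W j)ᴴ * scaledKraus W j
      = ((((d : ℝ) ^ 2 - 1)⁻¹ : ℝ) : ℂ) • (1 : Matrix (Fin d) (Fin d) ℂ) := fun j => by
    rw [conjTranspose_scaledKraus_mul hd, ← star_eq_conjTranspose,
      (Matrix.mem_unitaryGroup_iff').1 (hW j)]
  rw [Finset.sum_congr rfl fun j _ => h j, Finset.sum_const, Finset.card_univ,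
    ← Nat.cast_smul_eq_nsmul ℂ, smul_smul, ← Complex.ofReal_natCast, hc, ← Complex.ofReal_mul,
    mul_inv_cancel₀ (by nlinarith), Complex.ofReal_one, one_smul]

/-- Parseval's identity for a pure state and an orthogonal family of traceless unitary operators. -/
theorem IsTracelessUnitaryFamily.sum_norm_sq (hd : 2 ≤ d) {W : ι → Matrix (Fin d) (Fin d) ℂ}
    (hW : IsTracelessUnitaryFamily W) {ψ : Fin d → ℂ} (hψ : star ψ ⬝ᵥ ψ = 1) :
    ∑ j, ‖star ψ ⬝ᵥ W j *ᵥ ψ‖ ^ 2 = (d : ℝ) - 1 := by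
  classical
  obtain ⟨hc, hu, ht, ho⟩ := hW
  have hd0 : (d : ℂ) ≠ 0 := by norm_cast; omega
  -- Adjoining the identity at `none` gives `d²` orthogonal matrices of squared norm `d`.
  let V : Option ι → Matrix (Fin d) (Fin d) ℂ := fun o => o.elim 1 W
  have hV : ∀ o p, ((V o)ᴴ * V p).trace = if o = p then (d : ℂ) else 0 := by
    rintro (_ | j) (_ | k)
    · simp [V]
    · simp [V, ht]
    · simp [V, ht]
    · rcases eq_or_ne j k with rfl | h
      · have := (Matrix.mem_unitaryGroup_iff').1 (hu j)
        rw [star_eq_conjTranspose] at this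
        simp [V, this]
      · simpa [V, h, hsInner] using ho j k h
  let B : Matrix (Option ι) (Fin d × Fin d) ℂ := of fun o p => V o p.1 p.2
  let C : Matrix (Fin d × Fin d) (Option ι) ℂ := (d : ℂ)⁻¹ • Bᴴ
  have hBC : B * C = 1 := by
    ext o p
    have h1 := hV p o
    simp only [trace, diag_apply, Matrix.mul_apply, conjTranspose_apply] at h1
    rw [Matrix.mul_smul, Matrix.smul_apply, Matrix.mul_apply]
    simp only [B, of_apply, conjTranspose_apply, Fintype.sum_prod_type_right, smul_eq_mul,
      mul_comm (V o _ _), h1, one_apply, eq_comm (a := p)]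
    split_ifs <;> simp [hd0]
  -- The cardinality hypothesis makes `B` square, so orthogonality of its rows gives that of its
  -- columns, that is, completeness.
  have hCB : C * B = 1 := (mul_eq_one_comm_of_card_eq _ _ _ (by simp [hc, ← pow_two])).1 hBC
  let v : Fin d × Fin d → ℂ := fun p => star (ψ p.1) * ψ p.2
  have hv : star v ⬝ᵥ v = 1 := by
    have : star v ⬝ᵥ v = (star ψ ⬝ᵥ ψ) * (star ψ ⬝ᵥ ψ) := by
      simp only [dotProduct, Finset.sum_mul_sum, Fintype.sum_prod_type, v, Pi.star_apply, star_mul',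
        star_star]
      exact Finset.sum_congr rfl fun i _ => Finset.sum_congr rfl fun j _ => by ring
    rw [this, hψ, one_mul]
  have hB : ∀ o, (B *ᵥ v) o = star ψ ⬝ᵥ V o *ᵥ ψ := fun o => by
    simp only [mulVec, dotProduct, B, v, of_apply, Fintype.sum_prod_type, Finset.mul_sum,
      Pi.star_apply]
    exact Finset.sum_congr rfl fun i _ => Finset.sum_congr rfl fun j _ => by ring
  have hpars : star (B *ᵥ v) ⬝ᵥ (B *ᵥ v) = d := by
    have h1 : Bᴴ * B = (d : ℂ) • (1 : Matrix (Fin d × Fin d) (Fin d × Fin d) ℂ) := by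
      rw [← hCB, Matrix.smul_mul, smul_smul, mul_inv_cancel₀ hd0, one_smul]
    rw [star_mulVec, ← dotProduct_mulVec, mulVec_mulVec, h1, smul_mulVec, one_mulVec,
      dotProduct_smul, hv, smul_eq_mul, mul_one]
  -- The identity contributes the summand 1 to the total `d`, which leaves `d - 1`.
  have h3 : star (B *ᵥ v) ⬝ᵥ (B *ᵥ v) = ((1 + ∑ j, ‖star ψ ⬝ᵥ W j *ᵥ ψ‖ ^ 2 : ℝ) : ℂ) := by
    rw [dotProduct]
    simp only [Pi.star_apply, Complex.star_def, Complex.conj_mul', Fintype.sum_option, hB, V,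
      Option.elim, one_mulVec, hψ]
    push_cast
    simp
  rw [h3] at hpars
  have : 1 + ∑ j, ‖star ψ ⬝ᵥ W j *ᵥ ψ‖ ^ 2 = (d : ℝ) := by exact_mod_cast hpars
  linarith

variable [DecidableEq ι]

theorem traceNorm_scaledKraus_pure (hd : 2 ≤ d) {W : ι → Matrix (Fin d) (Fin d) ℂ}
    (hW : ∀ j, W j ∈ Matrix.unitaryGroup (Fin d) ℂ) {ψ : Fin d → ℂ} (hψ : star ψ ⬝ᵥ ψ = 1) :
    traceNorm ((flaggedChannel (scaledKraus fun _ : ι => (1 : Matrix (Fin d) (Fin d) ℂ)) -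
        flaggedChannel (scaledKraus W)) (vecMulVec ψ (star ψ)))
      = 2 / ((d : ℝ) ^ 2 - 1) * ∑ j, √(1 - ‖star ψ ⬝ᵥ W j *ᵥ ψ‖ ^ 2) := by
  have h2 : (2 : ℝ) ≤ d := by exact_mod_cast hd
  have hpos : (0 : ℝ) ≤ ((d : ℝ) ^ 2 - 1)⁻¹ := inv_nonneg.2 (by nlinarith)
  rw [traceNorm_flaggedChannel_sub, Finset.mul_sum]
  refine Finset.sum_congr rfl fun j _ => ?_
  have hφ : star (W j *ᵥ ψ) ⬝ᵥ (W j *ᵥ ψ) = 1 := by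
    rw [star_mulVec, ← dotProduct_mulVec, mulVec_mulVec, ← star_eq_conjTranspose,
      (Matrix.mem_unitaryGroup_iff').1 (hW j), one_mulVec, hψ]
  rw [scaledKraus_mul_mul_conjTranspose hd, scaledKraus_mul_mul_conjTranspose hd, ← smul_sub,
    conjTranspose_one, Matrix.one_mul, Matrix.mul_one, mul_vecMulVec, vecMulVec_mul,
    ← star_mulVec, traceNorm_smul_vecMulVec_sub hψ hφ hpos]
  ring

theorem isGreatest_neNorm_scaledKraus (hd : 2 ≤ d) {W : ι → Matrix (Fin d) (Fin d) ℂ}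
    (hW : ∀ j, W j ∈ Matrix.unitaryGroup (Fin d) ℂ) :
    IsGreatest {r : ℝ | ∃ ψ : Fin d → ℂ, star ψ ⬝ᵥ ψ = 1 ∧
        r = 2 / ((d : ℝ) ^ 2 - 1) * ∑ j, √(1 - ‖star ψ ⬝ᵥ (W j *ᵥ ψ)‖ ^ 2)}
      (neNorm (flaggedChannel (scaledKraus fun _ : ι => 1) - flaggedChannel (scaledKraus W))) := by
  have : NeZero d := ⟨by omega⟩
  obtain ⟨⟨ψ, hψ, he⟩, hle⟩ := exists_pure_isGreatest_neNorm
    (isHermitian_flaggedChannel_sub (scaledKraus fun _ : ι => 1) (scaledKraus W))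
  refine ⟨⟨ψ, hψ, ?_⟩, ?_⟩
  · rw [he, traceNorm_scaledKraus_pure hd hW hψ]
  · rintro r ⟨φ, hφ, rfl⟩
    rw [← traceNorm_scaledKraus_pure hd hW hφ]
    exact hle _ (isDensity_vecMulVec hφ)

end UnitaryFamily

/-- Jensen's inequality for the square root, with its case of equality. -/
theorem sum_sqrt_le_card_mul {ι : Type} [Fintype ι] {y : ι → ℝ} (hy : ∀ j, 0 ≤ y j) {t : ℝ}
    (ht : 0 < t) (hs : ∑ j, y j = Fintype.card ι * t ^ 2) :
    ∑ j, √(y j) ≤ Fintype.card ι * t ∧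
      (∑ j, √(y j) = Fintype.card ι * t ↔ ∀ j, y j = t ^ 2) := by
  -- The deficit in Jensen's inequality is a sum of squares, which gives both the bound and its
  -- equality case.
  have key : ∑ j, (√(y j) - t) ^ 2 = 2 * t * (Fintype.card ι * t - ∑ j, √(y j)) := by
    have : ∀ j, (√(y j) - t) ^ 2 = y j - 2 * t * √(y j) + t ^ 2 := fun j => by
      rw [sub_sq, Real.sq_sqrt (hy j)]; ring
    simp only [this, Finset.sum_add_distrib, Finset.sum_sub_distrib, hs, ← Finset.mul_sum]
    simp
    ring
  have h0 : 0 ≤ ∑ j, (√(y j) - t) ^ 2 := Finset.sum_nonneg fun j _ => sq_nonneg _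
  refine ⟨?_, fun h => ?_, fun h => ?_⟩
  · rw [key] at h0
    have := nonneg_of_mul_nonneg_right h0 (by linarith)
    linarith
  · rw [h, sub_self, mul_zero, Finset.sum_eq_zero_iff_of_nonneg fun j _ => sq_nonneg _] at key
    intro j
    have := key j (Finset.mem_univ j)
    rw [← sub_eq_zero.1 (pow_eq_zero_iff two_ne_zero |>.1 this), Real.sq_sqrt (hy j)]
  · simp [h, Real.sqrt_sq ht.le]

/-! ### The bound without ancilla and its equality case. -/

section UnitaryFamilyBounds

variable {d : ℕ} {ι : Type} [Fintype ι]

theorem two_mul_sqrt_lt_two : 2 * √((d : ℝ) / ((d : ℝ) + 1)) < 2 := by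
  have h : √((d : ℝ) / ((d : ℝ) + 1)) < 1 := by
    rw [Real.sqrt_lt' one_pos, one_pow, div_lt_one (by positivity)]
    linarith
  linarith

/-- By Parseval the `d² - 1` numbers `1 - |⟨ψ, Wⱼ ψ⟩|²` have mean `1 - (d - 1) / (d² - 1) = d / (d +
1)`; Jensen does the rest. -/
theorem IsTracelessUnitaryFamily.sum_sqrt_le (hd : 2 ≤ d) {W : ι → Matrix (Fin d) (Fin d) ℂ}
    (hW : IsTracelessUnitaryFamily W) {ψ : Fin d → ℂ} (hψ : star ψ ⬝ᵥ ψ = 1) :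
    2 / ((d : ℝ) ^ 2 - 1) * ∑ j, √(1 - ‖star ψ ⬝ᵥ W j *ᵥ ψ‖ ^ 2) ≤ 2 * √((d : ℝ) / ((d : ℝ) + 1)) ∧
      (2 / ((d : ℝ) ^ 2 - 1) * ∑ j, √(1 - ‖star ψ ⬝ᵥ W j *ᵥ ψ‖ ^ 2)
          = 2 * √((d : ℝ) / ((d : ℝ) + 1)) ↔
        ∀ j, ‖star ψ ⬝ᵥ W j *ᵥ ψ‖ ^ 2 = 1 / ((d : ℝ) + 1)) := by
  have h2 : (2 : ℝ) ≤ d := by exact_mod_cast hd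
  have hc : (Fintype.card ι : ℝ) = (d : ℝ) ^ 2 - 1 := by
    rw [eq_sub_iff_add_eq]; exact_mod_cast hW.1
  have hn : (0 : ℝ) < (d : ℝ) ^ 2 - 1 := by nlinarith
  have hp := hW.sum_norm_sq hd hψ
  have hle : ∀ j, ‖star ψ ⬝ᵥ W j *ᵥ ψ‖ ^ 2 ≤ 1 := by
    intro j
    have hφ : star (W j *ᵥ ψ) ⬝ᵥ (W j *ᵥ ψ) = 1 := by
      rw [star_mulVec, ← dotProduct_mulVec, mulVec_mulVec, ← star_eq_conjTranspose,
        (Matrix.mem_unitaryGroup_iff').1 (hW.2.1 j), one_mulVec, hψ]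
    exact norm_dotProduct_sq_le_one hψ hφ
  have ht2 : √((d : ℝ) / ((d : ℝ) + 1)) ^ 2 = d / (d + 1) := Real.sq_sqrt (by positivity)
  obtain ⟨h3, h4⟩ := sum_sqrt_le_card_mul (y := fun j => 1 - ‖star ψ ⬝ᵥ W j *ᵥ ψ‖ ^ 2)
    (fun j => sub_nonneg.2 (hle j)) (t := √((d : ℝ) / ((d : ℝ) + 1)))
    (Real.sqrt_pos.2 (by positivity)) (by
      rw [Finset.sum_sub_distrib, hp, ht2, Finset.sum_const, Finset.card_univ, nsmul_eq_mul, hc]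
      field_simp
      ring)
  rw [hc] at h3 h4
  rw [ht2] at h4
  set S := ∑ j, √(1 - ‖star ψ ⬝ᵥ W j *ᵥ ψ‖ ^ 2)
  set t := √((d : ℝ) / ((d : ℝ) + 1))
  refine ⟨?_, ?_⟩
  · rw [div_mul_eq_mul_div, div_le_iff₀ hn]
    nlinarith
  · have h5 : 2 / ((d : ℝ) ^ 2 - 1) * S = 2 * t ↔ S = ((d : ℝ) ^ 2 - 1) * t := by
      rw [div_mul_eq_mul_div, div_eq_iff hn.ne']
      constructor <;> intro h <;> linarith
    rw [h5, h4]
    refine forall_congr' fun j => ?_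
    have h6 : (d : ℝ) / (d + 1) = 1 - 1 / (d + 1) := by field_simp; ring
    rw [h6]
    exact sub_right_inj

theorem IsTracelessUnitaryFamily.hypotheses (hd : 2 ≤ d) {W : ι → Matrix (Fin d) (Fin d) ℂ}
    (hW : IsTracelessUnitaryFamily W) :
    ∑ j, (scaledKraus (fun _ : ι => (1 : Matrix (Fin d) (Fin d) ℂ)) j)ᴴ *
        scaledKraus (fun _ : ι => 1) j = 1 ∧
      ∑ j, (scaledKraus W j)ᴴ * scaledKraus W j = 1 ∧
      ∀ j, hsInner (scaledKraus (fun _ : ι => (1 : Matrix (Fin d) (Fin d) ℂ)) j)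
        (scaledKraus W j) = 0 := by
  refine ⟨sum_conjTranspose_scaledKraus_mul hd hW.1 fun _ => one_mem _,
    sum_conjTranspose_scaledKraus_mul hd hW.1 hW.2.1, fun j => ?_⟩
  rw [hsInner, conjTranspose_scaledKraus_mul hd, conjTranspose_one, Matrix.one_mul, trace_smul,
    hW.2.2.1, smul_zero]

variable [DecidableEq ι]

theorem IsTracelessUnitaryFamily.neNorm_le (hd : 2 ≤ d) {W : ι → Matrix (Fin d) (Fin d) ℂ}
    (hW : IsTracelessUnitaryFamily W) :
    neNorm (flaggedChannel (scaledKraus fun _ : ι => 1) - flaggedChannel (scaledKraus W))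
        ≤ 2 * √((d : ℝ) / ((d : ℝ) + 1)) ∧
      (neNorm (flaggedChannel (scaledKraus fun _ : ι => 1) - flaggedChannel (scaledKraus W))
          = 2 * √((d : ℝ) / ((d : ℝ) + 1)) ↔
        ∃ ψ : Fin d → ℂ, star ψ ⬝ᵥ ψ = 1 ∧
          ∀ j, ‖star ψ ⬝ᵥ (W j *ᵥ ψ)‖ ^ 2 = 1 / ((d : ℝ) + 1)) := by
  obtain ⟨⟨ψ, hψ, he⟩, hle⟩ := isGreatest_neNorm_scaledKraus hd hW.2.1
  obtain ⟨h1, h2⟩ := hW.sum_sqrt_le hd hψ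
  rw [← he] at h1 h2
  refine ⟨h1, fun h => ⟨ψ, hψ, h2.1 h⟩, ?_⟩
  rintro ⟨φ, hφ, h⟩
  exact le_antisymm h1 (((hW.sum_sqrt_le hd hφ).2.2 h).symm.trans_le (hle ⟨φ, hφ, rfl⟩))

end UnitaryFamilyBounds

/-! ### Discrete Weyl operators. -/

section Weyl

variable {d : ℕ}

/-- The primitive root of unity `exp (2 π i / d)`. -/
noncomputable def weylRoot (d : ℕ) : ℂ := Complex.exp (2 * Real.pi * Complex.I / d)

theorem weyl_apply (p : Fin d × Fin d) (i k : Fin d) :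
    weyl p i k = if i = k + p.1 then weylRoot d ^ ((p.2 : ℕ) * (k : ℕ)) else 0 := by
  rw [weyl, of_apply, weylRoot, ← Complex.exp_nat_mul]
  have : (i : ℕ) = ((k : ℕ) + (p.1 : ℕ)) % d ↔ i = k + p.1 := by
    rw [Fin.ext_iff, Fin.val_add]
  simp only [this]
  congr 2
  push_cast
  ring

variable [NeZero d]

theorem isPrimitiveRoot_weylRoot : IsPrimitiveRoot (weylRoot d) d :=
  Complex.isPrimitiveRoot_exp d (NeZero.ne d)

theorem weylRoot_pow_mod (m : ℕ) : weylRoot d ^ (m % d) = weylRoot d ^ m :=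
  (pow_eq_pow_mod m isPrimitiveRoot_weylRoot.pow_eq_one).symm

theorem norm_weylRoot_pow (m : ℕ) : ‖weylRoot d ^ m‖ = 1 := by
  rw [norm_pow, isPrimitiveRoot_weylRoot.norm'_eq_one (NeZero.ne d), one_pow]

/-- Weyl operators multiply like the parameters are added, up to phase factors. -/
theorem weyl_mul_weyl (p r : Fin d × Fin d) :
    weyl p * weyl r = weylRoot d ^ ((p.2 : ℕ) * (r.1 : ℕ)) • weyl (p + r) := by
  ext i k
  simp only [Matrix.mul_apply, Matrix.smul_apply, weyl_apply, smul_eq_mul, mul_ite, mul_zero,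
    Finset.sum_ite_eq', Finset.mem_univ, if_true, Prod.fst_add, Prod.snd_add]
  have h : k + r.1 + p.1 = k + (p.1 + r.1) := by abel
  rw [h, ite_mul, zero_mul]
  congr 1
  have h1 : weylRoot d ^ ((p.2 : ℕ) * ((k + r.1 : Fin d) : ℕ))
      = weylRoot d ^ ((p.2 : ℕ) * ((k : ℕ) + r.1)) := by
    rw [← weylRoot_pow_mod, ← weylRoot_pow_mod (_ * (_ + _)), Fin.val_add, Nat.mul_mod,
      Nat.mod_mod, ← Nat.mul_mod]
  have h2 : weylRoot d ^ (((p.2 + r.2 : Fin d) : ℕ) * (k : ℕ))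
      = weylRoot d ^ (((p.2 : ℕ) + r.2) * (k : ℕ)) := by
    rw [← weylRoot_pow_mod, ← weylRoot_pow_mod ((_ + _) * _), Fin.val_add, Nat.mul_mod,
      Nat.mod_mod, ← Nat.mul_mod]
  rw [h1, h2, ← pow_add, ← pow_add]
  congr 1
  ring

theorem weyl_mem_unitaryGroup (p : Fin d × Fin d) : weyl p ∈ unitaryGroup (Fin d) ℂ := by
  rw [mem_unitaryGroup_iff', star_eq_conjTranspose]
  ext k l
  have h1 : ∀ m : ℕ, (starRingEnd ℂ) (weylRoot d) ^ m * weylRoot d ^ m = 1 := fun m => by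
    rw [← map_pow, Complex.conj_mul', norm_weylRoot_pow]; simp
  simp only [Matrix.mul_apply, conjTranspose_apply, weyl_apply, apply_ite star, star_zero,
    mul_ite, mul_zero, Finset.sum_ite_eq', Finset.mem_univ, if_true,
    add_left_inj, one_apply, ite_mul, zero_mul, eq_comm (a := l)]
  split_ifs with h
  · rw [h, star_pow, Complex.star_def, h1]
  · rfl

/-- A nonzero shift has empty diagonal; without a shift the trace is a geometric sum over a
nontrivial `d`-th root of unity. -/
theorem trace_weyl {p : Fin d × Fin d} (hp : p ≠ 0) : (weyl p).trace = 0 := by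
  simp only [trace, diag_apply, weyl_apply, left_eq_add]
  by_cases h1 : p.1 = 0
  · have h2 : p.2 ≠ 0 := fun h => hp (Prod.ext h1 h)
    simp only [h1, if_true, pow_mul]
    have h3 : weylRoot d ^ (p.2 : ℕ) ≠ 1 :=
      isPrimitiveRoot_weylRoot.pow_ne_one_of_pos_of_lt (fun h => h2 (Fin.ext h)) p.2.2
    rw [Fin.sum_univ_eq_sum_range fun k => (weylRoot d ^ (p.2 : ℕ)) ^ k]
    have h4 := mul_neg_geom_sum (weylRoot d ^ (p.2 : ℕ)) d
    rw [← pow_mul, mul_comm _ d, pow_mul, isPrimitiveRoot_weylRoot.pow_eq_one, one_pow,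
      sub_self] at h4
    exact (mul_eq_zero.1 h4).resolve_left (sub_ne_zero.2 h3.symm)
  · simp [h1]

/-- Multiply `W_p W_{q-p} = phase · W_q` by `W_p*` on the left. -/
theorem conjTranspose_weyl_mul_weyl (p q : Fin d × Fin d) :
    ∃ c : ℂ, ‖c‖ = 1 ∧ (weyl p)ᴴ * weyl q = c • weyl (q - p) := by
  refine ⟨(weylRoot d ^ ((p.2 : ℕ) * ((q - p).1 : ℕ)))⁻¹, ?_, ?_⟩
  · rw [norm_inv, norm_weylRoot_pow, inv_one]
  · have h1 := weyl_mul_weyl p (q - p)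
    have h2 := (mem_unitaryGroup_iff').1 (weyl_mem_unitaryGroup p)
    have h3 : weylRoot d ^ ((p.2 : ℕ) * ((q - p).1 : ℕ)) ≠ 0 := by
      rw [← norm_ne_zero_iff, norm_weylRoot_pow]; exact one_ne_zero
    rw [add_sub_cancel] at h1
    rw [← inv_smul_eq_iff₀ h3] at h1
    rw [← h1, Matrix.mul_smul, ← Matrix.mul_assoc, ← star_eq_conjTranspose, h2, Matrix.one_mul]

theorem weylIndex_ne_zero (p : WeylIndex d) : p.1 ≠ 0 := fun h => p.2 (by simp [h])

theorem isTracelessUnitaryFamily_weyl :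
    IsTracelessUnitaryFamily fun p : WeylIndex d => weyl p.1 := by
  refine ⟨?_, fun p => weyl_mem_unitaryGroup _, fun p => trace_weyl (weylIndex_ne_zero p),
    fun p q hpq => ?_⟩
  · have h1 : Fintype.card {p : Fin d × Fin d // (p.1 : ℕ) = 0 ∧ (p.2 : ℕ) = 0} = 1 := by
      rw [Fintype.card_eq_one_iff]
      exact ⟨⟨0, by simp⟩, fun p => Subtype.ext (Prod.ext (Fin.ext p.2.1) (Fin.ext p.2.2))⟩
    have h2 := Fintype.card_subtype_compl
      (fun p : Fin d × Fin d => (p.1 : ℕ) = 0 ∧ (p.2 : ℕ) = 0)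
    rw [h1, Fintype.card_prod, Fintype.card_fin, ← pow_two] at h2
    have h3 : 0 < d ^ 2 := pow_pos (NeZero.pos d) 2
    rw [h2]
    omega
  · obtain ⟨c, -, hc⟩ := conjTranspose_weyl_mul_weyl p.1 q.1
    rw [hsInner, hc, trace_smul, trace_weyl (sub_ne_zero.2 fun h => hpq (Subtype.ext h.symm)),
      smul_zero]

/-- Fiducial vectors of a Weyl–Heisenberg covariant family of equiangular lines. -/
theorem weyl_fiducial_iff (ψ : Fin d → ℂ) (s : ℝ) :
    (∀ j : WeylIndex d, ‖star ψ ⬝ᵥ (weyl j.1 *ᵥ ψ)‖ ^ 2 = s) ↔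
      ∀ p q : Fin d × Fin d, p ≠ q → ‖star (weyl p *ᵥ ψ) ⬝ᵥ (weyl q *ᵥ ψ)‖ ^ 2 = s := by
  have key : ∀ p q : Fin d × Fin d, ‖star (weyl p *ᵥ ψ) ⬝ᵥ (weyl q *ᵥ ψ)‖
      = ‖star ψ ⬝ᵥ (weyl (q - p) *ᵥ ψ)‖ := by
    intro p q
    obtain ⟨c, hc1, hc⟩ := conjTranspose_weyl_mul_weyl p q
    rw [star_mulVec, ← dotProduct_mulVec, mulVec_mulVec, hc, smul_mulVec, dotProduct_smul,
      norm_smul, hc1, one_mul]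
  refine ⟨fun h p q hpq => ?_, fun h j => ?_⟩
  · rw [key]
    refine h ⟨q - p, fun h0 => hpq ?_⟩
    exact (sub_eq_zero.1 (Prod.ext (Fin.ext h0.1) (Fin.ext h0.2))).symm
  -- The pair `(-j, 0)` has difference `j`.
  · have := h (-j.1) 0 (neg_ne_zero.2 (weylIndex_ne_zero j))
    rwa [key, zero_sub, neg_neg] at this

end Weyl

theorem mainTheorem5 (d : ℕ) (hd : 2 ≤ d) :
    -- flagged channels in general
    (∀ (ι : Type) [Fintype ι] [DecidableEq ι] (A₀ A₁ : ι → Matrix (Fin d) (Fin d) ℂ),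
      ∑ j, (A₀ j)ᴴ * A₀ j = 1 → ∑ j, (A₁ j)ᴴ * A₁ j = 1 →
      (IsChannel (flaggedChannel A₀) ∧ IsChannel (flaggedChannel A₁)) ∧
      IsGreatest
        {r : ℝ | ∃ ρ : Matrix (Fin d) (Fin d) ℂ, IsDensity ρ ∧
          r = ∑ j, traceNorm (A₀ j * ρ * (A₀ j)ᴴ - A₁ j * ρ * (A₁ j)ᴴ)}
        (neNorm (flaggedChannel A₀ - flaggedChannel A₁)) ∧
      ((∀ j, hsInner (A₀ j) (A₁ j) = 0) →
        diamondNorm (flaggedChannel A₀ - flaggedChannel A₁) = 2 ∧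
        ∀ (κ : Type) [Fintype κ] [DecidableEq κ], d ≤ Fintype.card κ →
          loccNorm κ (flaggedChannel A₀ - flaggedChannel A₁) = 2 ∧
          ∃ ρ : Matrix (Fin d × κ) (Fin d × κ) ℂ, IsDensity ρ ∧
            ∃ P₀ P₁ : Matrix ((ι × Fin d) × κ) ((ι × Fin d) × κ) ℂ, IsFiniteLOCC P₀ P₁ ∧
              hsInner P₀ (ampliation (flaggedChannel A₀) κ ρ) = 1 ∧
              hsInner P₁ (ampliation (flaggedChannel A₁) κ ρ) = 1)) ∧
    -- orthogonal families of traceless unitary operators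
    (∀ (ι : Type) [Fintype ι] [DecidableEq ι] (W : ι → Matrix (Fin d) (Fin d) ℂ),
      IsTracelessUnitaryFamily W →
      ∀ Δ : Matrix (Fin d) (Fin d) ℂ →ₗ[ℂ] Matrix (ι × Fin d) (ι × Fin d) ℂ,
      Δ = flaggedChannel (scaledKraus fun _ : ι => 1) - flaggedChannel (scaledKraus W) →
      (∑ j, (scaledKraus (fun _ : ι => (1 : Matrix (Fin d) (Fin d) ℂ)) j)ᴴ *
          scaledKraus (fun _ : ι => 1) j = 1 ∧
        ∑ j, (scaledKraus W j)ᴴ * scaledKraus W j = 1) ∧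
      diamondNorm Δ = 2 ∧
      (∀ (κ : Type) [Fintype κ] [DecidableEq κ], d ≤ Fintype.card κ → loccNorm κ Δ = 2) ∧
      IsGreatest
        {r : ℝ | ∃ ψ : Fin d → ℂ, star ψ ⬝ᵥ ψ = 1 ∧
          r = 2 / ((d : ℝ) ^ 2 - 1) *
            ∑ j, Real.sqrt (1 - ‖star ψ ⬝ᵥ (W j *ᵥ ψ)‖ ^ 2)}
        (neNorm Δ) ∧
      neNorm Δ ≤ 2 * Real.sqrt ((d : ℝ) / ((d : ℝ) + 1)) ∧
      2 * Real.sqrt ((d : ℝ) / ((d : ℝ) + 1)) < 2 ∧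
      (neNorm Δ = 2 * Real.sqrt ((d : ℝ) / ((d : ℝ) + 1)) ↔
        ∃ ψ : Fin d → ℂ, star ψ ⬝ᵥ ψ = 1 ∧
          ∀ j, ‖star ψ ⬝ᵥ (W j *ᵥ ψ)‖ ^ 2 = 1 / ((d : ℝ) + 1))) ∧
    -- the discrete Weyl operators
    (∀ W : WeylIndex d → Matrix (Fin d) (Fin d) ℂ, (W = fun p => weyl p.1) →
      ∀ Δ : Matrix (Fin d) (Fin d) ℂ →ₗ[ℂ]
          Matrix (WeylIndex d × Fin d) (WeylIndex d × Fin d) ℂ,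
      Δ = flaggedChannel (scaledKraus fun _ : WeylIndex d => 1) - flaggedChannel (scaledKraus W) →
      IsTracelessUnitaryFamily W ∧
      diamondNorm Δ = 2 ∧
      (∀ (κ : Type) [Fintype κ] [DecidableEq κ], d ≤ Fintype.card κ → loccNorm κ Δ = 2) ∧
      neNorm Δ ≤ 2 * Real.sqrt ((d : ℝ) / ((d : ℝ) + 1)) ∧
      2 * Real.sqrt ((d : ℝ) / ((d : ℝ) + 1)) < 2 ∧
      (neNorm Δ = 2 * Real.sqrt ((d : ℝ) / ((d : ℝ) + 1)) ↔
        ∃ ψ : Fin d → ℂ, star ψ ⬝ᵥ ψ = 1 ∧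
          ∀ p q : Fin d × Fin d, p ≠ q →
            ‖star (weyl p *ᵥ ψ) ⬝ᵥ (weyl q *ᵥ ψ)‖ ^ 2 = 1 / ((d : ℝ) + 1))) := by

  have : NeZero d := ⟨by omega⟩
  refine ⟨?_, ?_, ?_⟩
  · intro ι _ _ A₀ A₁ h₀ h₁
    refine ⟨⟨isChannel_flaggedChannel h₀, isChannel_flaggedChannel h₁⟩,
      isGreatest_neNorm_flaggedChannel_sub A₀ A₁, fun horth =>
      ⟨diamondNorm_flaggedChannel_sub h₀ h₁ horth, fun κ _ _ hκ =>
        ⟨loccNorm_flaggedChannel_sub h₀ h₁ horth hκ,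
          exists_perfect_discrimination h₀ h₁ horth hκ⟩⟩⟩
  · rintro ι _ _ W hW Δ rfl
    obtain ⟨h₀, h₁, horth⟩ := hW.hypotheses hd
    exact ⟨⟨h₀, h₁⟩, diamondNorm_flaggedChannel_sub h₀ h₁ horth,
      fun κ _ _ hκ => loccNorm_flaggedChannel_sub h₀ h₁ horth hκ,
      isGreatest_neNorm_scaledKraus hd hW.2.1, (hW.neNorm_le hd).1, two_mul_sqrt_lt_two,
      (hW.neNorm_le hd).2⟩
  · rintro W rfl Δ rfl
    have hW := isTracelessUnitaryFamily_weyl (d := d)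
    obtain ⟨h₀, h₁, horth⟩ := hW.hypotheses hd
    refine ⟨hW, diamondNorm_flaggedChannel_sub h₀ h₁ horth,
      fun κ _ _ hκ => loccNorm_flaggedChannel_sub h₀ h₁ horth hκ, (hW.neNorm_le hd).1,
      two_mul_sqrt_lt_two, (hW.neNorm_le hd).2.trans ?_⟩
    exact exists_congr fun ψ => and_congr_right fun _ => weyl_fiducial_iff ψ _
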